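/- Let $\mathbb{C}_+$ be the open upper half-plane. For $p\in\{2,\infty\}$ let $\mathcal{H}^p_+$ be the Hardy space of holomorphic functions $F$ on $\mathbb{C}_+$ with $\sup_{y>0}\|F(\cdot+iy)\|_{L^p(\mathbb{R})}<\infty$, identified with the subspace of $L^p(\mathbb{R})$ formed by their non-tangential boundary functions. An inner function is a $q\in\mathcal{H}^\infty_+$ with $|q|=1$ a.e. on $\mathbb{R}$. An outer function is a function $$F(z)=\exp\Big(\frac{1}{\pi i}\int_{\mathbb{R}}\Big(\frac{1}{t-z}-\frac{t}{1+t^2}\Big)u(t)\,dt\Big),\qquad z\in\mathbb{C}_+,$$ with $u$ real-valued and $\int_{\mathbb{R}}\frac{|u(t)|}{1+t^2}\,dt<\infty$. Let $\mathcal{N}^+$ be the Smirnov class, i.e. the set of non-tangential boundary functions on $\mathbb{R}$ (defined a.e.) of quotients $G/F$ with $G,F\in\mathcal{H}^\infty_+$ and $F$ outer, and let $\overline{\mathcal{N}^+}=\{\overline{\varphi}:\varphi\in\mathcal{N}^+\}$. Let $q$ be an inner function and $E_2=q\mathcal{H}^2_+$. For $g\in L^\infty(\mathbb{R})$ let $T_g^{\mathcal{H}^2_+,E_2}:\mathcal{H}^2_+\to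 E_2$ be the generalized Toeplitz operator $f\mapsto P_{E_2}(gf)$, where $P_{E_2}$ is the orthogonal projection of $L^2(\mathbb{R})$ onto $E_2$. Proposition. Let $g,h\in L^\infty(\mathbb{R})$ be non-zero functions such that the kernels $\ker T_g^{\mathcal{H}^2_+,E_2}$ and $\ker T_h^{\mathcal{H}^2_+,E_2}$ are both non-trivial (that is, different from $\{0\}$). Then $$hg^{-1}\in\overline{\mathcal{N}^+}\quad\Longleftrightarrow\quad \ker T_g^{\mathcal{H}^2_+,E_2}\subseteq\ker T_h^{\mathcal{H}^2_+,E_2}.$$ -/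

import Mathlib

open MeasureTheory Filter Topology
open scoped ENNReal NNReal

noncomputable section

namespace ToeplitzKernel

/-- The open upper half-plane `ℂ₊`, as a subset of `ℂ`. -/
def upperHalf : Set ℂ := {z : ℂ | 0 < z.im}

/-- The Stolz angle of aperture `a` at the boundary point `x`. -/
def stolzAngle (a x : ℝ) : Set ℂ := {z : ℂ | 0 < z.im ∧ |z.re - x| < a * z.im}

/-- `F` has the non-tangential limit `l` at the boundary point `x`. -/
def HasNontangentialLimit (F : ℂ → ℂ) (x : ℝ) (l : ℂ) : Prop :=
  ∀ a : ℝ, 0 < a → Tendsto F (𝓝[stolzAngle a x] (x : ℂ)) (𝓝 l)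

/-- `f` is the non-tangential boundary function of `F`, almost everywhere on `ℝ`. -/
def HasBoundaryFunction (F : ℂ → ℂ) (f : ℝ → ℂ) : Prop :=
  ∀ᵐ x : ℝ, HasNontangentialLimit F x (f x)

/-- `F` belongs to the Hardy space `𝓗ᵖ(ℂ₊)`: it is holomorphic on `ℂ₊` and its `Lᵖ` norms along
horizontal lines are bounded.  Only the values of `F` on `ℂ₊` matter. -/
def IsHardy (p : ℝ≥0∞) (F : ℂ → ℂ) : Prop :=
  DifferentiableOn ℂ F upperHalf ∧
    ∃ C : ℝ≥0, ∀ y : ℝ, 0 < y →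
      eLpNorm (fun x : ℝ => F ((x : ℂ) + (y : ℂ) * Complex.I)) p volume ≤ C

/-- `F` is an outer function on `ℂ₊`, with `u` in the role of `log |F|` on the boundary:
`F(z) = exp ((1/(πi)) ∫ (1/(t-z) - t/(1+t²)) u(t) dt)`, where `u(t)/(1+t²)` is integrable. -/
def IsOuter (F : ℂ → ℂ) : Prop :=
  ∃ u : ℝ → ℝ, Integrable (fun t : ℝ => u t / (1 + t ^ 2)) ∧
    ∀ z ∈ upperHalf, F z = Complex.exp
      (1 / ((Real.pi : ℂ) * Complex.I) *
        ∫ t : ℝ, (1 / ((t : ℂ) - z) - (t : ℂ) / (1 + (t : ℂ) ^ 2)) * (u t : ℂ))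

/-- The Smirnov class `𝓝⁺(ℂ₊)`: quotients `G / F` with `G, F ∈ 𝓗^∞(ℂ₊)` and `F` outer. -/
def IsSmirnov (Φ : ℂ → ℂ) : Prop :=
  ∃ G F : ℂ → ℂ, IsHardy ∞ G ∧ IsHardy ∞ F ∧ IsOuter F ∧ ∀ z ∈ upperHalf, Φ z = G z / F z

/-- The Smirnov class `𝓝⁺` on `ℝ`: boundary functions of members of `𝓝⁺(ℂ₊)`. -/
def smirnov : Set (ℝ → ℂ) := {φ | ∃ Φ : ℂ → ℂ, IsSmirnov Φ ∧ HasBoundaryFunction Φ φ}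

/-- The class of complex conjugates of members of `𝓝⁺`. -/
def conjSmirnov : Set (ℝ → ℂ) := {φ | (fun x => (starRingEnd ℂ) (φ x)) ∈ smirnov}

lemma continuous_horizontal {F : ℂ → ℂ} (hF : DifferentiableOn ℂ F upperHalf) {y : ℝ}
    (hy : 0 < y) : Continuous (fun x : ℝ => F ((x : ℂ) + (y : ℂ) * Complex.I)) := by
  refine hF.continuousOn.comp_continuous (by fun_prop) (fun x => ?_)
  simpa [upperHalf] using hy

/-- The Hardy space `𝓗ᵖ₊`, as the subspace of `Lᵖ(ℝ)` of boundary functions. -/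
def hardy (p : ℝ≥0∞) [Fact (1 ≤ p)] : Submodule ℂ (Lp ℂ p (volume : Measure ℝ)) where
  carrier := {f | ∃ F : ℂ → ℂ, IsHardy p F ∧ HasBoundaryFunction F f}
  zero_mem' := by
    refine ⟨fun _ => 0, ⟨differentiableOn_const 0, 0, fun y _ => by simp⟩, ?_⟩
    filter_upwards [Lp.coeFn_zero ℂ p (volume : Measure ℝ)] with x hx
    rw [hx]
    exact fun a _ => tendsto_const_nhds
  add_mem' := by
    rintro f g ⟨F, ⟨hF, C, hC⟩, hFf⟩ ⟨G, ⟨hG, D, hD⟩, hGg⟩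
    refine ⟨fun z => F z + G z, ⟨hF.add hG, C + D, fun y hy => ?_⟩, ?_⟩
    · have h := eLpNorm_add_le (μ := volume) (p := p)
        (continuous_horizontal hF hy).aestronglyMeasurable
        (continuous_horizontal hG hy).aestronglyMeasurable Fact.out
      refine h.trans ?_
      push_cast
      exact add_le_add (hC y hy) (hD y hy)
    · filter_upwards [Lp.coeFn_add f g, hFf, hGg] with x hx h1 h2
      rw [hx]
      exact fun a ha => (h1 a ha).add (h2 a ha)
  smul_mem' := by
    rintro c f ⟨F, ⟨hF, C, hC⟩, hFf⟩
    refine ⟨fun z => c * F z, ⟨hF.const_mul c, ‖c‖₊ * C, fun y hy => ?_⟩, ?_⟩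
    · have h := eLpNorm_const_smul_le (μ := volume) (p := p) (c := c)
        (f := fun x : ℝ => F ((x : ℂ) + (y : ℂ) * Complex.I))
      refine h.trans ?_
      push_cast
      exact mul_le_mul' le_rfl (hC y hy)
    · filter_upwards [Lp.coeFn_smul c f, hFf] with x hx h1
      rw [hx]
      exact fun a ha => (h1 a ha).const_mul c

/-- An inner function, given by its boundary function in `L^∞(ℝ)`. -/
def IsInner (q : Lp ℂ ∞ (volume : Measure ℝ)) : Prop :=
  q ∈ hardy ∞ ∧ ∀ᵐ x : ℝ, ‖q x‖ = 1

/-- The multiplication operator `M_g` on `L²(ℝ)` with symbol `g ∈ L^∞(ℝ)`. -/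
def mulOp (g : Lp ℂ ∞ (volume : Measure ℝ)) :
    Lp ℂ 2 (volume : Measure ℝ) →L[ℂ] Lp ℂ 2 (volume : Measure ℝ) :=
  (ContinuousLinearMap.mul ℂ ℂ).holderL volume ∞ 2 2 g

lemma coeFn_mulOp (g : Lp ℂ ∞ (volume : Measure ℝ)) (f : Lp ℂ 2 (volume : Measure ℝ)) :
    mulOp g f =ᵐ[volume] fun x => g x * f x :=
  (ContinuousLinearMap.mul ℂ ℂ).coeFn_holder g f

/-- The subspace `q 𝓗²₊` of `L²(ℝ)`. -/
def shiftedHardy (q : Lp ℂ ∞ (volume : Measure ℝ)) : Submodule ℂ (Lp ℂ 2 (volume : Measure ℝ)) :=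
  (hardy 2).map (mulOp q).toLinearMap

/-- The generalized Toeplitz operator `T_g^{E₁,E₂} f = P_{E₂} (g f)` on `E₁`.  The closure makes
the orthogonal projection available for every `E₂`; it changes nothing when `E₂` is closed. -/
def toeplitz (g : Lp ℂ ∞ (volume : Measure ℝ))
    (E₁ E₂ : Submodule ℂ (Lp ℂ 2 (volume : Measure ℝ))) :
    E₁ →L[ℂ] E₂.topologicalClosure :=
  E₂.topologicalClosure.orthogonalProjectionOnto ∘L mulOp g ∘L E₁.subtypeL

/-- The kernel of `T_g^{E₁,E₂}`, as a subspace of `L²(ℝ)`. -/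
def toeplitzKer (g : Lp ℂ ∞ (volume : Measure ℝ))
    (E₁ E₂ : Submodule ℂ (Lp ℂ 2 (volume : Measure ℝ))) :
    Submodule ℂ (Lp ℂ 2 (volume : Measure ℝ)) :=
  (LinearMap.ker (toeplitz g E₁ E₂).toLinearMap).map E₁.subtype

/-- The kernel consists of the `f ∈ E₁` with `g f ∈ E₂ᗮ`. -/
lemma mem_toeplitzKer {g : Lp ℂ ∞ (volume : Measure ℝ)}
    {E₁ E₂ : Submodule ℂ (Lp ℂ 2 (volume : Measure ℝ))} {f : Lp ℂ 2 (volume : Measure ℝ)} :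
    f ∈ toeplitzKer g E₁ E₂ ↔ f ∈ E₁ ∧ mulOp g f ∈ E₂ᗮ := by
  simp [toeplitzKer, toeplitz, Submodule.orthogonalProjectionOnto_eq_zero_iff,
    Submodule.orthogonal_closure, and_comm]

end ToeplitzKernel

end

/-! Write `k_g(f)` for the complex conjugate of `q̄ g f` (`conjSymbolMul q g f`). The orthogonal
complement of `𝓗²₊` consists of the conjugates of `𝓗²₊`, so `f ∈ 𝓗²₊` lies in the kernel of `T_g`
exactly when `k_g(f) ∈ 𝓗²₊`. Moreover `k_h(f) = conj (h / g) * k_g(f)`, so everything turns on the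
multiplier `conj (h / g)`.

If `conj (h / g) ∈ 𝓝⁺`, it carries `k_g(f) ∈ 𝓗²₊` to a function of `L²` that is Smirnov times `𝓗²₊`,
and the Smirnov theorem (`mem_hardy_of_mul_smirnov`) puts this function in `𝓗²₊`. For the converse,
one well-chosen `f` suffices. Start from any non-zero `f` in the kernel of `T_g` and factor `k_g(f)
= J o` with `o` outer and `|J| = 1` on `ℝ`. Then `J f` is again in `𝓗²₊` and `k_g(J f) = conj J *
k_g(f) = o`, so the kernel contains a function whose `k_g` is outer
(`exists_mem_toeplitzKer_outer`). If this function is also in the kernel of `T_h`, then `conj (h /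
g) = k_h(J f) / o` is an `𝓗²` function over an outer `𝓗²` function, hence Smirnov
(`div_mem_smirnov`).

The Hardy space theory behind this rests on Poisson integrals: Fatou's theorem, the Poisson
representation of `𝓗²` (contour shift and weak compactness), Cauchy kernels for the orthogonal
complement, and the maximum principle `IsHardy.norm_le_exp_mul_integral`, which yields
log-integrability, the outer factor and both Smirnov statements. -/

noncomputable section

namespace ToeplitzKernel

/-- The Poisson kernel of the upper half-plane. -/
def poissonKernel (z : ℂ) (t : ℝ) : ℝ :=
  z.im / (Real.pi * ((t - z.re) ^ 2 + z.im ^ 2))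

/-- Harmonic measure on `ℝ` as seen from `z`: the measure with density the Poisson kernel. -/
def poisson (z : ℂ) : Measure ℝ :=
  volume.withDensity fun t => ENNReal.ofReal (poissonKernel z t)

/-! ### Harmonic measure of the half-plane and its dependence on the base point. -/

section Kernel

variable {z w : ℂ}

lemma poissonKernel_pos (hz : 0 < z.im) (t : ℝ) : 0 < poissonKernel z t := by
  unfold poissonKernel
  positivity

lemma continuous_poissonKernel (hz : 0 < z.im) : Continuous (poissonKernel z) := by
  unfold poissonKernel
  refine continuous_const.div (by fun_prop) fun t => ?_
  positivity

lemma poissonKernel_eq_cauchyPDFReal (hz : 0 < z.im) :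
    poissonKernel z = ProbabilityTheory.cauchyPDFReal z.re z.im.toNNReal := by
  ext t
  rw [ProbabilityTheory.cauchyPDFReal_def, poissonKernel]
  rw [Real.coe_toNNReal _ hz.le]
  have : (t - z.re) ^ 2 + z.im ^ 2 ≠ 0 := by positivity
  field_simp

lemma integrable_poissonKernel (hz : 0 < z.im) : Integrable (poissonKernel z) := by
  rw [poissonKernel_eq_cauchyPDFReal hz]
  exact ProbabilityTheory.integrable_cauchyPDFReal _

lemma integral_poissonKernel (hz : 0 < z.im) : ∫ t, poissonKernel z t = 1 := by
  rw [poissonKernel_eq_cauchyPDFReal hz]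
  refine ProbabilityTheory.integral_cauchyPDFReal_eq_one _ ?_
  simpa using hz

lemma isProbabilityMeasure_poisson (hz : 0 < z.im) : IsProbabilityMeasure (poisson z) := by
  refine ⟨?_⟩
  rw [poisson, withDensity_apply _ MeasurableSet.univ, Measure.restrict_univ,
    ← ofReal_integral_eq_lintegral_ofReal (integrable_poissonKernel hz)
      (ae_of_all _ fun t => (poissonKernel_pos hz t).le), integral_poissonKernel hz,
    ENNReal.ofReal_one]

lemma measurable_ofReal_poissonKernel (z : ℂ) :
    Measurable fun t => ENNReal.ofReal (poissonKernel z t) := by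
  unfold poissonKernel
  fun_prop

lemma lintegral_poisson (z : ℂ) (v : ℝ → ℝ≥0∞) :
    ∫⁻ t, v t ∂poisson z = ∫⁻ t, ENNReal.ofReal (poissonKernel z t) * v t := by
  rw [poisson, lintegral_withDensity_eq_lintegral_mul_non_measurable _
    (measurable_ofReal_poissonKernel z) (ae_of_all _ fun t => ENNReal.ofReal_lt_top)]
  rfl

variable {E : Type*} [NormedAddCommGroup E] [NormedSpace ℝ E]

lemma integral_poisson (hz : 0 < z.im) (f : ℝ → E) :
    ∫ t, f t ∂poisson z = ∫ t, poissonKernel z t • f t := by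
  rw [poisson, integral_withDensity_eq_integral_toReal_smul (measurable_ofReal_poissonKernel z)
    (ae_of_all _ fun t => ENNReal.ofReal_lt_top)]
  simp_rw [ENNReal.toReal_ofReal (poissonKernel_pos hz _).le]

lemma integrable_poisson_iff (hz : 0 < z.im) {f : ℝ → E} :
    Integrable f (poisson z) ↔ Integrable fun t => poissonKernel z t • f t := by
  rw [poisson, integrable_withDensity_iff_integrable_smul' (measurable_ofReal_poissonKernel z)
    (ae_of_all _ fun t => ENNReal.ofReal_lt_top)]
  simp_rw [ENNReal.toReal_ofReal (poissonKernel_pos hz _).le]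

lemma poisson_absolutelyContinuous (z : ℂ) : poisson z ≪ volume :=
  withDensity_absolutelyContinuous _ _

lemma absolutelyContinuous_poisson (hz : 0 < z.im) : volume ≪ poisson z :=
  withDensity_absolutelyContinuous' (measurable_ofReal_poissonKernel z).aemeasurable
    (ae_of_all _ fun t => (ENNReal.ofReal_pos.2 (poissonKernel_pos hz t)).ne')

lemma poisson_le_smul {K : ℝ≥0} (h : ∀ t, poissonKernel z t ≤ K * poissonKernel w t) :
    poisson z ≤ K • poisson w := by
  have : K • poisson w = volume.withDensity
      ((K : ℝ≥0∞) • fun t => ENNReal.ofReal (poissonKernel w t)) := by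
    rw [withDensity_smul _ (measurable_ofReal_poissonKernel w)]
    rfl
  rw [this]
  refine withDensity_mono (ae_of_all _ fun t => ?_)
  simp only [Pi.smul_apply, smul_eq_mul]
  rw [← ENNReal.ofReal_coe_nnreal, ← ENNReal.ofReal_mul K.coe_nonneg]
  exact ENNReal.ofReal_le_ofReal (h t)

/-- A Harnack inequality, from `(a + b)² ≤ 2a² + 2b²` with `a = t - z.re` and `b = z.re - w.re`. It
makes integrability against harmonic measure independent of the base point, so hypotheses can be
stated at `i` only. -/
lemma poissonKernel_le_mul (hz : 0 < z.im) (hw : 0 < w.im) (t : ℝ) :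
    poissonKernel z t ≤
      (z.im / w.im * (2 + (2 * (z.re - w.re) ^ 2 + w.im ^ 2) / z.im ^ 2)) *
        poissonKernel w t := by
  unfold poissonKernel
  rw [mul_div_assoc', div_le_div_iff₀ (by positivity) (by positivity)]
  have h1 : (t - w.re) ^ 2 + w.im ^ 2 ≤ (2 + (2 * (z.re - w.re) ^ 2 + w.im ^ 2) / z.im ^ 2) *
      ((t - z.re) ^ 2 + z.im ^ 2) := by
    have h2 : (2 + (2 * (z.re - w.re) ^ 2 + w.im ^ 2) / z.im ^ 2) *
      ((t - z.re) ^ 2 + z.im ^ 2) = 2 * (t - z.re) ^ 2 + 2 * z.im ^ 2 +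
        (2 * (z.re - w.re) ^ 2 + w.im ^ 2) +
        (2 * (z.re - w.re) ^ 2 + w.im ^ 2) / z.im ^ 2 * (t - z.re) ^ 2 := by
      field_simp
      ring
    have h3 : 0 ≤ (2 * (z.re - w.re) ^ 2 + w.im ^ 2) / z.im ^ 2 * (t - z.re) ^ 2 := by positivity
    rw [h2]
    nlinarith [sq_nonneg (t - z.re - (z.re - w.re)), sq_nonneg z.im]
  calc z.im * (Real.pi * ((t - w.re) ^ 2 + w.im ^ 2))
      ≤ z.im * (Real.pi * ((2 + (2 * (z.re - w.re) ^ 2 + w.im ^ 2) / z.im ^ 2) *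
      ((t - z.re) ^ 2 + z.im ^ 2))) := by gcongr
    _ = _ := by field_simp

lemma exists_poisson_le_smul (hz : 0 < z.im) (hw : 0 < w.im) :
    ∃ K : ℝ≥0, poisson z ≤ K • poisson w :=
  ⟨(z.im / w.im * (2 + (2 * (z.re - w.re) ^ 2 + w.im ^ 2) / z.im ^ 2)).toNNReal,
    poisson_le_smul fun t => by
      rw [Real.coe_toNNReal _ (by positivity)]
      exact poissonKernel_le_mul hz hw t⟩

lemma Integrable.poisson {F : Type*} [NormedAddCommGroup F] {f : ℝ → F}
    (hf : Integrable f (poisson w)) (hw : 0 < w.im) (hz : 0 < z.im) :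
    Integrable f (poisson z) := by
  obtain ⟨K, hK⟩ := exists_poisson_le_smul hz hw
  exact (hf.smul_measure_nnreal (c := K)).mono_measure hK

lemma integrable_poisson_I_iff {u : ℝ → ℝ} :
    Integrable u (poisson Complex.I) ↔ Integrable fun t => u t / (1 + t ^ 2) := by
  rw [integrable_poisson_iff (by simp)]
  have : (fun t => poissonKernel Complex.I t • u t) =
      fun t => Real.pi⁻¹ * (u t / (1 + t ^ 2)) := by
    ext t
    simp [poissonKernel]
    field_simp
    ring
  rw [this, integrable_const_mul_iff (by simp [Real.pi_ne_zero])]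

lemma memLp_poissonKernel (hz : 0 < z.im) : MemLp (poissonKernel z) 2 := by
  rw [memLp_two_iff_integrable_sq (continuous_poissonKernel hz).aestronglyMeasurable]
  refine ((integrable_poissonKernel hz).const_mul (1 / (Real.pi * z.im))).mono'
    ((continuous_poissonKernel hz).pow 2).aestronglyMeasurable (ae_of_all _ fun t => ?_)
  have h := poissonKernel_pos hz t
  rw [Real.norm_of_nonneg (by positivity), pow_two]
  refine mul_le_mul_of_nonneg_right ?_ h.le
  unfold poissonKernel
  rw [div_le_div_iff₀ (by positivity) (by positivity)]
  nlinarith [Real.pi_pos, mul_nonneg Real.pi_pos.le (sq_nonneg (t - z.re))]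

lemma MemLp.integrable_poisson (hz : 0 < z.im) {f : ℝ → E} (hf : MemLp f 2) :
    Integrable f (poisson z) := by
  rw [integrable_poisson_iff hz]
  have : MemLp (fun t => poissonKernel z t • f t) 1 :=
    hf.smul (memLp_poissonKernel hz)
  exact memLp_one_iff_integrable.1 this

end Kernel

/-! ### Fatou's theorem on non-tangential limits. -/

section Fatou

/-- A nonnegative function whose means over balls around `x` are bounded by a constant has Poisson
integral over `x` bounded by a multiple of this constant. -/
lemma lintegral_poisson_le_of_closedBall {x y : ℝ} (hy : 0 < y) {v : ℝ → ℝ≥0∞}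
    (hv : AEMeasurable v) {A : ℝ≥0∞}
    (hA : ∀ r > 0, ∫⁻ t in Metric.closedBall x r, v t ≤ A * ENNReal.ofReal r) :
    ∫⁻ t, v t ∂poisson ⟨x, y⟩ ≤ 8 * A := by
  -- Dyadic decomposition: for the least `k` with `|t - x| ≤ 2 ^ k * y`, the kernel is at most `4 /
  -- (4 ^ k * y)`. The ball of radius `2 ^ k * y` then contributes at most `4 A / 2 ^ k`, and these
  -- sum to `8 A`.
  have key : ∀ t, ENNReal.ofReal (poissonKernel ⟨x, y⟩ t) * v t ≤
      ∑' k : ℕ, ENNReal.ofReal (4 / (4 ^ k * y)) *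
        (Metric.closedBall x (2 ^ k * y)).indicator v t := by
    intro t
    have hex : ∃ k : ℕ, |t - x| ≤ 2 ^ k * y := by
      obtain ⟨k, hk⟩ := pow_unbounded_of_one_lt (|t - x| / y) (one_lt_two)
      exact ⟨k, ((div_lt_iff₀ hy).1 hk).le⟩
    classical
    set k := Nat.find hex with hk
    have hk1 : |t - x| ≤ 2 ^ k * y := Nat.find_spec hex
    refine le_trans ?_ (ENNReal.le_tsum k)
    rw [Set.indicator_of_mem (by simpa [Real.dist_eq] using hk1)]
    gcongr
    unfold poissonKernel
    simp only
    have hpi : (1 : ℝ) ≤ Real.pi := by linarith [Real.pi_gt_three]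
    rcases Nat.eq_zero_or_pos k with h0 | h0
    · rw [h0, div_le_div_iff₀ (by positivity) (by positivity)]
      nlinarith [sq_nonneg (t - x), mul_nonneg Real.pi_pos.le (sq_nonneg (t - x)), sq_nonneg y]
    · obtain ⟨j, hj⟩ := Nat.exists_eq_succ_of_ne_zero h0.ne'
      have hlt : 2 ^ j * y < |t - x| := by
        by_contra! hcon
        exact Nat.find_min hex (m := j) (by omega) hcon
      have hsq : (2 ^ j * y) ^ 2 ≤ (t - x) ^ 2 := by
        rw [← sq_abs (t - x)]
        exact pow_le_pow_left₀ (by positivity) hlt.le 2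
      rw [hj, div_le_div_iff₀ (by positivity) (by positivity)]
      have h4 : (4 : ℝ) ^ (j + 1) = 4 * (2 ^ j) ^ 2 := by
        rw [pow_succ, ← pow_mul, mul_comm j 2, pow_mul]
        norm_num [mul_comm]
      rw [Nat.succ_eq_add_one, h4]
      nlinarith [sq_nonneg y, mul_nonneg Real.pi_pos.le (sq_nonneg y), sq_nonneg (t - x)]
  rw [lintegral_poisson]
  refine (lintegral_mono key).trans ?_
  rw [lintegral_tsum fun k => (hv.indicator measurableSet_closedBall).const_mul _]
  have hterm : ∀ k : ℕ, ∫⁻ t, ENNReal.ofReal (4 / (4 ^ k * y)) *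
      (Metric.closedBall x (2 ^ k * y)).indicator v t ≤
        A * ENNReal.ofReal (4 * (1 / 2) ^ k) := by
    intro k
    rw [lintegral_const_mul' _ _ ENNReal.ofReal_ne_top,
      lintegral_indicator measurableSet_closedBall]
    calc _ ≤ ENNReal.ofReal (4 / (4 ^ k * y)) * (A * ENNReal.ofReal (2 ^ k * y)) := by
          gcongr
          exact hA _ (by positivity)
      _ = A * (ENNReal.ofReal (4 / (4 ^ k * y)) * ENNReal.ofReal (2 ^ k * y)) := by ring
      _ = _ := by
          rw [← ENNReal.ofReal_mul (by positivity)]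
          congr 2
          have : (4 : ℝ) ^ k = 2 ^ k * 2 ^ k := by rw [← mul_pow]; norm_num
          rw [this, div_pow, one_pow]
          field_simp
  refine (ENNReal.tsum_le_tsum hterm).trans ?_
  rw [ENNReal.tsum_mul_left, ← ENNReal.ofReal_tsum_of_nonneg (fun k => by positivity)
    (summable_geometric_two.mul_left 4), tsum_mul_left, tsum_geometric_two, mul_comm]
  norm_num

variable {E : Type*} [NormedAddCommGroup E]

/-- Near `x` the Lebesgue point property controls the means over balls. At distance more than `δ`,
the kernel at height `y` is at most `y * C` times the kernel at height `1`, so the tail is `O(y)`.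
-/
lemma tendsto_lintegral_poisson_vertical {u : ℝ → E} {x : ℝ}
    (hu : Integrable u (poisson Complex.I))
    (hx : Tendsto (fun r => (∫⁻ t in Metric.closedBall x r, ‖u t - u x‖ₑ) /
      volume (Metric.closedBall x r)) (𝓝[>] 0) (𝓝 0)) :
    Tendsto (fun y : ℝ => ∫⁻ t, ‖u t - u x‖ₑ ∂poisson ⟨x, y⟩) (𝓝[>] 0) (𝓝 0) := by
  have hx1 : (0 : ℝ) < (⟨x, 1⟩ : ℂ).im := one_pos
  have hprob := isProbabilityMeasure_poisson hx1
  have hint : Integrable (fun t => u t - u x) (poisson ⟨x, 1⟩) :=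
    (Integrable.poisson hu (by simp) hx1).sub (integrable_const _)
  have hmeas : AEMeasurable (fun t => ‖u t - u x‖ₑ) :=
    (hint.1.mono_ac (absolutelyContinuous_poisson hx1)).enorm
  rw [ENNReal.tendsto_nhds_zero]
  intro ε hε
  rcases eq_or_ne ε ⊤ with rfl | hεtop
  · simp
  -- The ball of radius `r` has length `2 r`, which turns `ε / 32` into `ε / 16`; the factor `8` of
  -- the ball estimate then gives `ε / 2`.
  have hε' : 0 < ε / 32 := ENNReal.div_pos hε.ne' (by norm_num)
  obtain ⟨δ, hδ0, hδ⟩ : ∃ δ > 0, ∀ r ∈ Set.Ioc 0 δ,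
      ∫⁻ t in Metric.closedBall x r, ‖u t - u x‖ₑ ≤ ε / 16 * ENNReal.ofReal r := by
    have h := (ENNReal.tendsto_nhds_zero.1 hx) _ hε'
    obtain ⟨δ, hδ0, hδ⟩ := mem_nhdsGT_iff_exists_Ioc_subset.1 h
    refine ⟨δ, hδ0, fun r hr => ?_⟩
    have h1 := Set.mem_ofPred.1 (hδ hr)
    rw [ENNReal.div_le_iff (by simp [hr.1]) (by simp [ENNReal.mul_eq_top]), Real.volume_closedBall,
      ENNReal.ofReal_mul (by norm_num), ← mul_assoc] at h1
    refine h1.trans (mul_le_mul' (le_of_eq ?_) le_rfl)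
    rw [ENNReal.ofReal_ofNat, ENNReal.div_eq_inv_mul, ENNReal.div_eq_inv_mul,
      show (32 : ℝ≥0∞) = 16 * 2 by norm_num, ENNReal.mul_inv (by simp) (by simp)]
    rw [mul_right_comm, mul_assoc _ _ (2 : ℝ≥0∞), ENNReal.inv_mul_cancel (by simp) (by simp),
      mul_one]
  set v : ℝ → ℝ≥0∞ := fun t => ‖u t - u x‖ₑ with hvdef
  set B := Metric.closedBall x δ
  have hBm : MeasurableSet B := measurableSet_closedBall
  have hnear : ∀ y > 0, ∫⁻ t, B.indicator v t ∂poisson ⟨x, y⟩ ≤ ε / 2 := by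
    intro y hy
    refine (lintegral_poisson_le_of_closedBall (A := ε / 16) hy (hmeas.indicator hBm) ?_).trans
      (le_of_eq ?_)
    · intro r hr
      rw [setLIntegral_indicator hBm]
      have hsub : B ∩ Metric.closedBall x r ⊆ Metric.closedBall x (min δ r) := by
        intro t ht
        simpa [B] using ht
      refine (lintegral_mono_set hsub).trans ((hδ _ ⟨lt_min hδ0 hr, min_le_left _ _⟩).trans ?_)
      gcongr
      exact min_le_right _ _
    · rw [ENNReal.div_eq_inv_mul, ENNReal.div_eq_inv_mul, ← mul_assoc,
        show (16 : ℝ≥0∞) = 8 * 2 by norm_num, ENNReal.mul_inv (by simp) (by simp), ← mul_assoc,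
        ENNReal.mul_inv_cancel (by simp) (by simp), one_mul]
  set M := ∫⁻ t, v t ∂poisson ⟨x, 1⟩ with hM
  have hMtop : M ≠ ⊤ := hint.2.ne
  set C := (1 + δ ^ 2) / δ ^ 2 with hC
  have hfar : ∀ y > 0, ∫⁻ t, Bᶜ.indicator v t ∂poisson ⟨x, y⟩ ≤ ENNReal.ofReal (y * C) * M := by
    intro y hy
    rw [hM, lintegral_poisson, lintegral_poisson, ← lintegral_const_mul' _ _ ENNReal.ofReal_ne_top]
    refine lintegral_mono fun t => ?_
    by_cases ht : t ∈ B
    · rw [Set.indicator_of_notMem (by simpa using ht)]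
      simp
    · rw [Set.indicator_of_mem (by simpa using ht), ← mul_assoc,
        ← ENNReal.ofReal_mul (by positivity)]
      gcongr
      have hd : δ ≤ |t - x| := by
        simp only [B, Metric.mem_closedBall, Real.dist_eq, not_le] at ht
        exact ht.le
      have hd2 : δ ^ 2 ≤ (t - x) ^ 2 := by
        rw [← sq_abs (t - x)]
        exact pow_le_pow_left₀ hδ0.le hd 2
      have hpos : 0 < (t - x) ^ 2 := lt_of_lt_of_le (by positivity) hd2
      simp only [poissonKernel, hC]
      have : y * ((1 + δ ^ 2) / δ ^ 2) * (1 / (Real.pi * ((t - x) ^ 2 + 1 ^ 2))) =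
        (y * (1 + δ ^ 2)) / (Real.pi * (δ ^ 2 * ((t - x) ^ 2 + 1))) := by
        field_simp
      rw [this, div_le_div_iff₀ (by positivity) (by positivity)]
      have h1 : δ ^ 2 * ((t - x) ^ 2 + 1) ≤ (1 + δ ^ 2) * ((t - x) ^ 2 + y ^ 2) := by
        nlinarith [mul_nonneg (sq_nonneg δ) (sq_nonneg y), sq_nonneg y]
      calc y * (Real.pi * (δ ^ 2 * ((t - x) ^ 2 + 1)))
          ≤ y * (Real.pi * ((1 + δ ^ 2) * ((t - x) ^ 2 + y ^ 2))) := by gcongr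
        _ = _ := by ring
  have hlim : Tendsto (fun y : ℝ => ENNReal.ofReal (y * C) * M) (𝓝[>] 0) (𝓝 0) := by
    have h1 : Tendsto (fun y : ℝ => ENNReal.ofReal (y * C)) (𝓝[>] 0) (𝓝 0) := by
      have : Tendsto (fun y : ℝ => y * C) (𝓝[>] 0) (𝓝 (0 * C)) :=
        ((continuous_id.mul continuous_const).tendsto 0).mono_left nhdsWithin_le_nhds
      simpa using ENNReal.tendsto_ofReal this
    simpa using ENNReal.Tendsto.mul_const h1 (Or.inr hMtop)
  have hev := (ENNReal.tendsto_nhds_zero.1 hlim) (ε / 2) (ENNReal.half_pos hε.ne')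
  filter_upwards [hev, self_mem_nhdsWithin] with y hy1 hy0
  have hy0' : (0 : ℝ) < y := hy0
  have hsplit : ∀ t, v t = B.indicator v t + Bᶜ.indicator v t := fun t =>
    (congrFun (Set.indicator_self_add_compl B v) t).symm
  calc ∫⁻ t, v t ∂poisson ⟨x, y⟩
      = ∫⁻ t, B.indicator v t + Bᶜ.indicator v t ∂poisson ⟨x, y⟩ :=
        lintegral_congr hsplit
    _ = ∫⁻ t, B.indicator v t ∂poisson ⟨x, y⟩ + ∫⁻ t, Bᶜ.indicator v t ∂poisson ⟨x, y⟩ :=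
        lintegral_add_left' ((hmeas.indicator hBm).mono_ac (poisson_absolutelyContinuous _)) _
    _ ≤ ε / 2 + ε / 2 := add_le_add (hnear y hy0') ((hfar y hy0').trans hy1)
    _ = ε := ENNReal.add_halves ε

variable [NormedSpace ℝ E]

/-- In a Stolz angle the horizontal displacement is at most `a` times the height, so the comparison
constant depends on `a` alone. This upgrades vertical limits to non-tangential ones. -/
lemma poisson_le_smul_of_mem_stolzAngle {a x : ℝ} {z : ℂ} (hz : z ∈ stolzAngle a x) :
    poisson z ≤ (2 + 2 * a ^ 2).toNNReal • poisson ⟨x, z.im⟩ := by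
  obtain ⟨hz0, hz1⟩ := hz
  refine poisson_le_smul fun t => ?_
  rw [Real.coe_toNNReal _ (by positivity)]
  simp only [poissonKernel]
  have h1 : (z.re - x) ^ 2 ≤ (a * z.im) ^ 2 := by
    rw [← sq_abs (z.re - x)]
    exact pow_le_pow_left₀ (abs_nonneg _) hz1.le 2
  rw [mul_div_assoc', div_le_div_iff₀ (by positivity) (by positivity)]
  have h2 : (t - x) ^ 2 + z.im ^ 2 ≤ (2 + 2 * a ^ 2) * ((t - z.re) ^ 2 + z.im ^ 2) := by
    nlinarith [sq_nonneg (t - z.re - (z.re - x)), mul_nonneg (sq_nonneg a) (sq_nonneg (t - z.re)),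
      sq_nonneg z.im]
  calc z.im * (Real.pi * ((t - x) ^ 2 + z.im ^ 2))
      ≤ z.im * (Real.pi * ((2 + 2 * a ^ 2) * ((t - z.re) ^ 2 + z.im ^ 2))) := by gcongr
    _ = _ := by ring

lemma locallyIntegrable_of_integrable_poisson {u : ℝ → E}
    (hu : Integrable u (poisson Complex.I)) : LocallyIntegrable u := by
  rw [integrable_poisson_iff (by simp)] at hu
  have hc : Continuous fun t => (poissonKernel Complex.I t)⁻¹ :=
    (continuous_poissonKernel (by simp)).inv₀ fun t => (poissonKernel_pos (by simp) t).ne'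
  refine (hu.locallyIntegrable.continuous_smul hc).congr (ae_of_all _ fun t => ?_)
  exact inv_smul_smul₀ (poissonKernel_pos (by simp) t).ne' _

variable [CompleteSpace E] in
/-- **Fatou's theorem** on non-tangential limits of Poisson integrals. -/
theorem ae_tendsto_integral_poisson {u : ℝ → E} (hu : Integrable u (poisson Complex.I)) :
    ∀ᵐ x : ℝ, ∀ a : ℝ, Tendsto (fun z => ∫ t, u t ∂poisson z)
      (𝓝[stolzAngle a x] (x : ℂ)) (𝓝 (u x)) := by
  filter_upwards [(Besicovitch.vitaliFamily (volume : Measure ℝ)).ae_tendsto_lintegral_enorm_sub_div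
    (locallyIntegrable_of_integrable_poisson hu)] with x hx a
  have h1 := tendsto_lintegral_poisson_vertical hu (hx.comp (Besicovitch.tendsto_filterAt volume x))
  have him : Tendsto Complex.im (𝓝[stolzAngle a x] (x : ℂ)) (𝓝[>] 0) := by
    refine tendsto_nhdsWithin_iff.2 ⟨?_, eventually_nhdsWithin_of_forall fun z hz => hz.1⟩
    simpa using (Complex.continuous_im.tendsto (x : ℂ)).mono_left nhdsWithin_le_nhds
  have h2 := h1.comp him
  have h3 := ENNReal.Tendsto.const_mul h2
    (a := ((2 + 2 * a ^ 2).toNNReal : ℝ≥0∞)) (Or.inr ENNReal.coe_ne_top)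
  rw [mul_zero] at h3
  rw [tendsto_iff_edist_tendsto_0]
  refine tendsto_of_tendsto_of_tendsto_of_le_of_le' tendsto_const_nhds h3
    (Eventually.of_forall fun z => zero_le) (eventually_nhdsWithin_of_forall fun z hz => ?_)
  have hprob := isProbabilityMeasure_poisson hz.1
  have hint := Integrable.poisson hu (by simp) hz.1
  have : ∫ t, u t ∂poisson z - u x = ∫ t, (u t - u x) ∂poisson z := by
    rw [integral_sub hint (integrable_const _)]
    simp
  rw [edist_eq_enorm_sub, this]
  refine (enorm_integral_le_lintegral_enorm _).trans ?_
  refine (lintegral_mono' (poisson_le_smul_of_mem_stolzAngle hz) le_rfl).trans (le_of_eq ?_)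
  rw [lintegral_smul_measure]
  rfl

end Fatou

/-! ### Poisson integrals and the norm of `L²`. -/

section Contraction

lemma lintegral_sq_le {μ : Measure ℝ} [IsProbabilityMeasure μ] {v : ℝ → ℝ≥0∞}
    (hv : AEMeasurable v μ) : (∫⁻ t, v t ∂μ) ^ 2 ≤ ∫⁻ t, v t ^ 2 ∂μ := by
  have h := ENNReal.lintegral_mul_le_Lp_mul_Lq μ Real.HolderConjugate.two_two hv
    (aemeasurable_const (b := (1 : ℝ≥0∞)))
  simp only [Pi.mul_apply, mul_one, lintegral_const, measure_univ,
    ENNReal.rpow_two, one_pow, ENNReal.one_rpow] at h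
  calc (∫⁻ t, v t ∂μ) ^ 2 ≤ ((∫⁻ t, v t ^ 2 ∂μ) ^ (1 / 2 : ℝ)) ^ 2 := by gcongr
    _ = _ := by rw [← ENNReal.rpow_two, ← ENNReal.rpow_mul]; norm_num

/-- Poisson integrals contract the norm of `L²`. -/
lemma lintegral_poisson_sq_le {v : ℝ → ℝ≥0∞} (hv : AEMeasurable v) {y : ℝ} (hy : 0 < y) :
    ∫⁻ x : ℝ, (∫⁻ t, v t ∂poisson ⟨x, y⟩) ^ 2 ≤ ∫⁻ t, v t ^ 2 := by
  have hmeas : Measurable fun p : ℝ × ℝ => ENNReal.ofReal (poissonKernel ⟨p.1, y⟩ p.2) := by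
    unfold poissonKernel
    fun_prop
  calc ∫⁻ x : ℝ, (∫⁻ t, v t ∂poisson ⟨x, y⟩) ^ 2
      ≤ ∫⁻ x : ℝ, ∫⁻ t, ENNReal.ofReal (poissonKernel ⟨x, y⟩ t) * v t ^ 2 := by
        refine lintegral_mono fun x => ?_
        have := isProbabilityMeasure_poisson (z := ⟨x, y⟩) hy
        rw [← lintegral_poisson _ fun t => v t ^ 2]
        exact lintegral_sq_le (hv.mono_ac (poisson_absolutelyContinuous _))
    _ = ∫⁻ t, ∫⁻ x : ℝ, ENNReal.ofReal (poissonKernel ⟨x, y⟩ t) * v t ^ 2 := by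
        refine lintegral_lintegral_swap (hmeas.aemeasurable.mul ?_)
        exact (hv.pow_const 2).comp_snd
    _ = ∫⁻ t, v t ^ 2 := by
        refine lintegral_congr fun t => ?_
        have hm : Measurable fun x => ENNReal.ofReal (poissonKernel ⟨x, y⟩ t) :=
          by
            simp only [poissonKernel]
            fun_prop
        rw [lintegral_mul_const _ hm]
        -- The kernel is symmetric in `x` and `t`, so its integral over `x` is also `1`.
        have hsymm : ∀ x, poissonKernel ⟨x, y⟩ t = poissonKernel ⟨t, y⟩ x := fun x => by
          unfold poissonKernel
          rw [sub_sq_comm]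
        simp_rw [hsymm]
        have := isProbabilityMeasure_poisson (z := ⟨t, y⟩) hy
        have h1 := lintegral_poisson ⟨t, y⟩ 1
        simp only [Pi.one_apply, lintegral_one, measure_univ, mul_one] at h1
        rw [← h1, one_mul]

lemma eLpNorm_two_le_iff {f : ℝ → ℂ} {C : ℝ≥0∞} :
    eLpNorm f 2 volume ≤ C ↔ ∫⁻ x, ‖f x‖ₑ ^ 2 ≤ C ^ 2 := by
  rw [eLpNorm_eq_lintegral_rpow_enorm_toReal (by simp) (by simp)]
  simp only [ENNReal.toReal_ofNat, ENNReal.rpow_two]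
  rw [one_div, ENNReal.rpow_inv_le_iff (by norm_num), ENNReal.rpow_two]

lemma isHardy_two_of_enorm_le {F : ℂ → ℂ} (hF : DifferentiableOn ℂ F upperHalf)
    {v : ℝ → ℝ≥0∞} (hv : AEMeasurable v) (hv2 : ∫⁻ t, v t ^ 2 < ⊤)
    (h : ∀ z ∈ upperHalf, ‖F z‖ₑ ≤ ∫⁻ t, v t ∂poisson z) : IsHardy 2 F := by
  refine ⟨hF, ((∫⁻ t, v t ^ 2) ^ (1 / 2 : ℝ)).toNNReal, fun y hy => ?_⟩
  rw [ENNReal.coe_toNNReal (ENNReal.rpow_ne_top_of_nonneg (by norm_num) hv2.ne),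
    eLpNorm_two_le_iff, ← ENNReal.rpow_two (_ ^ (1 / 2 : ℝ)), ← ENNReal.rpow_mul]
  norm_num
  refine le_trans (lintegral_mono fun x => ?_) (lintegral_poisson_sq_le hv hy)
  gcongr
  rw [← Complex.mk_eq_add_mul_I]
  exact h _ hy

end Contraction

/-! ### Shifting horizontal contours. -/

section Contour

lemma isOpen_upperHalf : IsOpen upperHalf := isOpen_lt continuous_const Complex.continuous_im

/-- The integral of a holomorphic function over horizontal lines does not depend on the line,
provided that the `L¹` norms on these lines are bounded. -/
lemma integral_horizontal_eq {G : ℂ → ℂ} {a b C : ℝ}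
    (hG : DifferentiableOn ℂ G {z | a ≤ z.im}) (hab : a ≤ b)
    (hint : ∀ y ∈ Set.Icc a b, Integrable fun x : ℝ => G (x + y * Complex.I))
    (hC : ∀ y ∈ Set.Icc a b, ∫ x : ℝ, ‖G (x + y * Complex.I)‖ ≤ C) :
    ∫ x : ℝ, G (x + a * Complex.I) = ∫ x : ℝ, G (x + b * Complex.I) := by
  set ν : Measure ℝ := volume.restrict (Set.Ioc a b) with hν
  have hmem : ∀ y ∈ Set.Ioc a b, y ∈ Set.Icc a b := fun y hy => Set.Ioc_subset_Icc_self hy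
  have hmeas : AEStronglyMeasurable (fun p : ℝ × ℝ => G (p.1 + p.2 * Complex.I))
      (volume.prod ν) := by
    have : (volume : Measure ℝ).prod ν =
        ((volume : Measure ℝ).prod volume).restrict (Set.univ ×ˢ Set.Ioc a b) := by
      rw [hν, ← Measure.prod_restrict, Measure.restrict_univ]
    rw [this]
    refine ContinuousOn.aestronglyMeasurable ?_ (MeasurableSet.univ.prod measurableSet_Ioc)
    refine hG.continuousOn.comp (by fun_prop) fun p hp => ?_
    simpa using hp.2.1.le
  have hprod : Integrable (fun p : ℝ × ℝ => G (p.1 + p.2 * Complex.I)) (volume.prod ν) := by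
    rw [integrable_prod_iff' hmeas]
    constructor
    · filter_upwards [ae_restrict_mem measurableSet_Ioc] with y hy using hint y (hmem y hy)
    · refine Integrable.of_bound hmeas.norm.prod_swap.integral_prod_right' C ?_
      filter_upwards [ae_restrict_mem measurableSet_Ioc] with y hy
      rw [Real.norm_of_nonneg (integral_nonneg fun _ => norm_nonneg _)]
      exact hC y (hmem y hy)
  -- `H` is the contribution of a vertical side of the rectangle. By Fubini it is integrable in the
  -- abscissa, which replaces any pointwise decay of `G`.
  set H : ℝ → ℂ := fun s => ∫ y in a..b, G (s + y * Complex.I) with hH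
  have hHint : Integrable H := by
    have := hprod.integral_prod_left
    simpa only [hH, intervalIntegral.integral_of_le hab] using this
  have hrect : ∀ R : ℝ, (∫ x in (-R)..R, G (x + a * Complex.I)) -
      (∫ x in (-R)..R, G (x + b * Complex.I)) = Complex.I * (H (-R) - H R) := by
    intro R
    have h := Complex.integral_boundary_rect_eq_zero_of_differentiableOn G
      ⟨-R, a⟩ ⟨R, b⟩ (hG.mono fun z hz => by
        have := (Complex.mem_reProdIm.1 hz).2
        rw [Set.uIcc_of_le hab] at this
        exact this.1)
    simp only [smul_eq_mul] at h
    simp only [hH]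
    linear_combination h
  have hlim : Tendsto (fun R : ℝ => Complex.I * (H (-R) - H R)) atTop
      (𝓝 ((∫ x : ℝ, G (x + a * Complex.I)) - ∫ x : ℝ, G (x + b * Complex.I))) := by
    simp_rw [← hrect]
    exact (intervalIntegral_tendsto_integral (hint a ⟨le_rfl, hab⟩) tendsto_neg_atTop_atBot
      tendsto_id).sub (intervalIntegral_tendsto_integral (hint b ⟨hab, le_rfl⟩)
      tendsto_neg_atTop_atBot tendsto_id)
  -- An integrable function that converges at infinity has limit zero.
  have hI : Integrable fun R : ℝ => Complex.I * (H (-R) - H R) :=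
    ((hHint.comp_neg).sub hHint).const_mul _
  refine sub_eq_zero.1 (IntegrableAtFilter.eq_zero_of_tendsto (l := atTop) (μ := volume)
    ⟨Set.univ, univ_mem, hI.integrableOn⟩ (fun s hs => ?_) hlim)
  obtain ⟨c, hc⟩ := mem_atTop_sets.1 hs
  exact measure_mono_top (fun x hx => hc x hx) (Real.volume_Ici (a := c))

end Contour

/-! ### Poisson representation of `𝓗²` functions. -/

section Representation

lemma IsHardy.memLp {F : ℂ → ℂ} (hF : IsHardy 2 F) {y : ℝ} (hy : 0 < y) :
    MemLp (fun x : ℝ => F (x + y * Complex.I)) 2 := by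
  obtain ⟨hd, C, hC⟩ := hF
  exact ⟨(continuous_horizontal hd hy).aestronglyMeasurable,
    (hC y hy).trans_lt ENNReal.coe_lt_top⟩

lemma IsHardy.integrable_sq {F : ℂ → ℂ} (hF : IsHardy 2 F) {y : ℝ} (hy : 0 < y) :
    Integrable fun x : ℝ => ‖F (x + y * Complex.I)‖ ^ 2 :=
  (memLp_two_iff_integrable_sq_norm (hF.memLp hy).1).1 (hF.memLp hy)

lemma IsHardy.exists_integral_sq_le {F : ℂ → ℂ} (hF : IsHardy 2 F) :
    ∃ C : ℝ, ∀ y : ℝ, 0 < y → ∫ x : ℝ, ‖F (x + y * Complex.I)‖ ^ 2 ≤ C := by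
  obtain ⟨hd, C, hC⟩ := id hF
  refine ⟨C ^ 2, fun y hy => ?_⟩
  have h := eLpNorm_two_le_iff.1 (hC y hy)
  rw [integral_eq_lintegral_of_nonneg_ae (ae_of_all _ fun _ => by positivity)
    (hF.integrable_sq hy).1]
  refine ENNReal.toReal_le_of_le_ofReal (by positivity) ?_
  rw [ENNReal.ofReal_pow C.coe_nonneg, ENNReal.ofReal_coe_nnreal]
  refine le_trans (le_of_eq (lintegral_congr fun x => ?_)) h
  rw [ENNReal.ofReal_pow (norm_nonneg _), ofReal_norm]

lemma norm_dslope_div_le {F : ℂ → ℂ} {W W' : ℂ} {x y s : ℝ} (hs : 0 < s)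
    (h1 : s ^ 2 ≤ (x - W.re) ^ 2 + (y - W.im) ^ 2) (h2 : W.re = W'.re)
    (h3 : (y - W.im) ^ 2 ≤ (y - W'.im) ^ 2) :
    ‖dslope F W (x + y * Complex.I) / (x + y * Complex.I - W')‖ ≤
      (‖F (x + y * Complex.I)‖ + ‖F W‖) / ((x - W.re) ^ 2 + (y - W.im) ^ 2) := by
  set z : ℂ := x + y * Complex.I with hz
  set m := (x - W.re) ^ 2 + (y - W.im) ^ 2 with hm
  have hm0 : 0 < m := lt_of_lt_of_le (by positivity) h1
  have hzW : ‖z - W‖ ^ 2 = m := by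
    rw [← Complex.normSq_eq_norm_sq, Complex.normSq_apply, hm]
    simp [hz]
    ring
  have hzW' : m ≤ ‖z - W'‖ ^ 2 := by
    rw [← Complex.normSq_eq_norm_sq, Complex.normSq_apply, hm]
    simp [hz, h2] at h3 ⊢
    nlinarith
  have hne : z ≠ W := by
    rintro h
    rw [h] at hzW
    simp at hzW
    exact hm0.ne hzW
  have hle : m ≤ ‖z - W‖ * ‖z - W'‖ := by
    refine le_of_sq_le_sq ?_ (by positivity)
    rw [mul_pow, hzW, pow_two]
    gcongr
  rw [dslope_of_ne _ hne, slope_def_field, div_div, norm_div, norm_mul]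
  exact div_le_div₀ (by positivity) (norm_sub_le _ _) hm0 hle

/-- Let `W'` be the reflection of `W = w + iε` in the line `Im = ε`. On this line the Poisson kernel
of `w` is a multiple of `1 / ((z - W) (z - W'))`, so the claim is that `(F z - F W) / ((z - W) (z -
W'))` has integral zero there. The singularity at `W` is removable (hence `dslope`) and `W'` lies
below the line, so the contour can be moved up, where the integral tends to zero. -/
lemma IsHardy.integral_poisson_shift {F : ℂ → ℂ} (hF : IsHardy 2 F) {ε : ℝ} (hε : 0 < ε) {w : ℂ}
    (hw : 0 < w.im) :
    ∫ t : ℝ, F (t + ε * Complex.I) ∂poisson w = F (w + ε * Complex.I) := by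
  obtain ⟨C, hC⟩ := hF.exists_integral_sq_le
  have hd := hF.1
  set W : ℂ := w + ε * Complex.I with hW
  set W' : ℂ := (starRingEnd ℂ) w + ε * Complex.I with hW'
  have hWre : W.re = w.re := by simp [hW]
  have hWim : W.im = w.im + ε := by simp [hW]
  have hWre' : W'.re = w.re := by simp [hW']
  have hWim' : W'.im = -w.im + ε := by simp [hW']
  have hWmem : W ∈ upperHalf := by
    show 0 < W.im
    rw [hWim]
    positivity
  set D : ℂ → ℂ := fun z => dslope F W z / (z - W') with hD
  have hDd : DifferentiableOn ℂ (fun z => dslope F W z / (z - W')) {z | ε ≤ z.im} := by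
    refine DifferentiableOn.div ?_ (by fun_prop) ?_
    · refine ((Complex.differentiableOn_dslope (isOpen_upperHalf.mem_nhds hWmem)).2 hd).mono ?_
      exact fun z hz => hε.trans_le hz
    · intro z hz h
      have := congrArg Complex.im h
      simp only [Complex.sub_im, hWim', Complex.zero_im] at this
      have hz' : ε ≤ z.im := hz
      linarith
  have hFD : ∀ y, ε ≤ y → ∀ x : ℝ, x + y * Complex.I ≠ W →
      D (x + y * Complex.I) = (F (x + y * Complex.I) - F W) /
        ((x + y * Complex.I - W) * (x + y * Complex.I - W')) := by
    intro y hy x hne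
    simp only [hD]
    rw [dslope_of_ne _ hne, slope_def_field, div_div]
  have hcont : ∀ y, ε ≤ y → Continuous fun x : ℝ => D (x + y * Complex.I) := fun y hy =>
    hDd.continuousOn.comp_continuous (by fun_prop) fun x => by simpa using hy
  have hW3 : ∀ y, ε ≤ y → (y - W.im) ^ 2 ≤ (y - W'.im) ^ 2 := by
    intro y hy
    rw [hWim, hWim']
    nlinarith
  set A := ‖F W‖ with hA
  have hA0 : 0 ≤ A := norm_nonneg _
  -- At distance at least `s` from `W`, the inequality `f ≤ f² + 1` trades `|F|` for `|F|²`, whose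
  -- integral is bounded uniformly in `y`. Both terms integrate to `O(1 / s)`.
  have hbound : ∀ s : ℝ, 1 ≤ s → ∀ x y : ℝ, ε ≤ y → s ^ 2 ≤ (x - W.re) ^ 2 + (y - W.im) ^ 2 →
      ‖D (x + y * Complex.I)‖ ≤ 1 / s * ‖F (x + y * Complex.I)‖ ^ 2 +
        (1 + A) * (2 * Real.pi / s) * poissonKernel ⟨w.re, s⟩ x := by
    intro s hs x y hy hsxy
    have hs0 : 0 < s := one_pos.trans_le hs
    refine (norm_dslope_div_le hs0 hsxy (by rw [hWre, hWre']) (hW3 y hy)).trans ?_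
    rw [hWre] at hsxy ⊢
    set m := (x - w.re) ^ 2 + (y - W.im) ^ 2 with hm
    have hm0 : 0 < m := lt_of_lt_of_le (by positivity) hsxy
    have hpk : 1 / m ≤ 2 * Real.pi / s * poissonKernel ⟨w.re, s⟩ x := by
      have : 2 * Real.pi / s * poissonKernel ⟨w.re, s⟩ x = 2 / ((x - w.re) ^ 2 + s ^ 2) := by
        simp only [poissonKernel]
        field_simp
      rw [this, div_le_div_iff₀ hm0 (by positivity)]
      nlinarith [sq_nonneg (y - W.im)]
    set f := ‖F (x + y * Complex.I)‖
    have h1 : (f + A) / m ≤ 1 / s * f ^ 2 + (1 + A) * (1 / m) := by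
      have hsm : s ≤ m := by nlinarith
      have h2 : f * (1 / m) ≤ 1 / s * f ^ 2 + 1 / m := by
        have h3 : 1 / m ≤ 1 / s := one_div_le_one_div_of_le hs0 hsm
        have h4 : 0 < 1 / m := by positivity
        nlinarith [sq_nonneg (f - 1), mul_nonneg (sub_nonneg.2 h3) (sq_nonneg f)]
      calc (f + A) / m = f * (1 / m) + A * (1 / m) := by ring
        _ ≤ _ := by linarith
    refine h1.trans ?_
    rw [mul_assoc]
    gcongr
  have hline : ∀ s : ℝ, 0 < s → ∀ K y : ℝ, ε ≤ y → ∀ c : ℝ, 0 ≤ c →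
      (∀ x : ℝ, ‖D (x + y * Complex.I)‖ ≤ c * ‖F (x + y * Complex.I)‖ ^ 2 +
        K * poissonKernel ⟨w.re, s⟩ x) →
      Integrable (fun x : ℝ => D (x + y * Complex.I)) ∧
        ∫ x : ℝ, ‖D (x + y * Complex.I)‖ ≤ c * C + K := by
    intro s hs K y hy c hc hb
    have hy0 := hε.trans_le hy
    have hi1 := (hF.integrable_sq hy0).const_mul c
    have hi2 := (integrable_poissonKernel (z := ⟨w.re, s⟩) hs).const_mul K
    have hi := (hi1.add hi2).mono' (hcont y hy).aestronglyMeasurable (ae_of_all _ hb)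
    refine ⟨hi, (integral_mono hi.norm (hi1.add hi2) hb).trans ?_⟩
    rw [integral_add' hi1 hi2, integral_const_mul, integral_const_mul,
      integral_poissonKernel (z := ⟨w.re, s⟩) hs, mul_one]
    gcongr
    exact hC y hy0
  -- Close to `W`, compactness bounds `D`. The constant may depend on `Y`: it only serves to justify
  -- the contour shift, not the limit.
  have hstrip : ∀ Y : ℝ, ∃ K : ℝ, ∀ y ∈ Set.Icc ε Y, ∀ x : ℝ,
      ‖D (x + y * Complex.I)‖ ≤ 1 * ‖F (x + y * Complex.I)‖ ^ 2 +
        K * poissonKernel ⟨w.re, 1⟩ x := by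
    intro Y
    have hcomp : IsCompact (Set.Icc (w.re - 1) (w.re + 1) ×ℂ Set.Icc ε Y) :=
      isCompact_Icc.reProdIm isCompact_Icc
    obtain ⟨M, hM⟩ := hcomp.exists_bound_of_continuousOn (hDd.continuousOn.mono fun z hz =>
      (Complex.mem_reProdIm.1 hz).2.1)
    refine ⟨(1 + A) * (2 * Real.pi / 1) + |M| * (2 * Real.pi), fun y hy x => ?_⟩
    have hpk0 := poissonKernel_pos (z := ⟨w.re, 1⟩) one_pos x
    by_cases hx : x ∈ Set.Icc (w.re - 1) (w.re + 1)
    · have h1 : ‖D (x + y * Complex.I)‖ ≤ |M| :=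
        (hM _ (Complex.mem_reProdIm.2 ⟨by simpa using hx, by simpa using hy⟩)).trans (le_abs_self M)
      have h2 : 1 ≤ 2 * Real.pi * poissonKernel ⟨w.re, 1⟩ x := by
        have : 2 * Real.pi * poissonKernel ⟨w.re, 1⟩ x = 2 / ((x - w.re) ^ 2 + 1) := by
          simp only [poissonKernel]
          field_simp
        rw [this, le_div_iff₀ (by positivity)]
        nlinarith [hx.1, hx.2]
      calc ‖D (x + y * Complex.I)‖ ≤ |M| * 1 := by rwa [mul_one]
        _ ≤ |M| * (2 * Real.pi * poissonKernel ⟨w.re, 1⟩ x) := by gcongr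
        _ = 0 + |M| * (2 * Real.pi) * poissonKernel ⟨w.re, 1⟩ x := by ring
        _ ≤ _ := by
          gcongr
          · positivity
          · have : 0 ≤ (1 + A) * (2 * Real.pi / 1) := by positivity
            linarith
    · refine (hbound 1 le_rfl x y hy.1 ?_).trans ?_
      · rw [hWre]
        have : 1 ≤ |x - w.re| := by
          by_contra! hcon
          rw [abs_lt] at hcon
          exact hx ⟨by linarith, by linarith⟩
        have h2 := one_le_sq_iff_one_le_abs _ |>.2 this
        nlinarith [sq_nonneg (y - W.im)]
      · rw [div_one (1 : ℝ)]
        gcongr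
        have : 0 ≤ |M| * (2 * Real.pi) := by positivity
        linarith
  have hlineε : ∀ y, ε ≤ y → Integrable (fun x : ℝ => D (x + y * Complex.I)) := by
    intro y hy
    obtain ⟨K, hK⟩ := hstrip y
    exact (hline 1 one_pos K y hy 1 zero_le_one (hK y ⟨hy, le_rfl⟩)).1
  have hzero : ∫ x : ℝ, D (x + ε * Complex.I) = 0 := by
    rw [← norm_le_zero_iff]
    have hle : ∀ s : ℝ, 1 ≤ s →
        ‖∫ x : ℝ, D (x + ε * Complex.I)‖ ≤ (C + (1 + A) * (2 * Real.pi)) / s := by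
      intro s hs
      have hY : ε ≤ W.im + s := by rw [hWim]; linarith
      obtain ⟨K, hK⟩ := hstrip (W.im + s)
      rw [integral_horizontal_eq hDd hY (fun y hy => hlineε y hy.1)
        (fun y hy => (hline 1 one_pos K y hy.1 1 zero_le_one (hK y hy)).2)]
      refine (norm_integral_le_integral_norm _).trans
        ((hline s (by linarith) _ _ hY (1 / s) (by positivity)
          fun x => hbound s hs x _ hY ?_).2.trans (le_of_eq ?_))
      · rw [add_sub_cancel_left]
        nlinarith [sq_nonneg (x - W.re)]
      · ring
    exact ge_of_tendsto (tendsto_const_nhds.div_atTop tendsto_id)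
      ((eventually_ge_atTop 1).mono hle)
  have hDw : ∀ t : ℝ, D (t + ε * Complex.I) =
      ((Real.pi / w.im : ℝ) : ℂ) * poissonKernel w t • (F (t + ε * Complex.I) - F W) := by
    intro t
    have hden : ((t + ε * Complex.I - W) * (t + ε * Complex.I - W')) =
        (((t - w.re) ^ 2 + w.im ^ 2 : ℝ) : ℂ) := by
      apply Complex.ext
      · rw [Complex.ofReal_re]
        simp [hW, hW']
        ring
      · rw [Complex.ofReal_im]
        simp [hW, hW']
        ring
    have hpos : 0 < (t - w.re) ^ 2 + w.im ^ 2 := by positivity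
    have hne : t + ε * Complex.I ≠ W := by
      intro h
      rw [h, sub_self, zero_mul] at hden
      exact hpos.ne (Complex.ofReal_injective (by simpa using hden))
    rw [hFD ε le_rfl t hne, hden, Complex.real_smul, ← mul_assoc, ← Complex.ofReal_mul,
      div_eq_inv_mul, ← Complex.ofReal_inv]
    congr 2
    unfold poissonKernel
    field_simp
  have hprob := isProbabilityMeasure_poisson hw
  simp_rw [hDw] at hzero
  rw [integral_const_mul, ← integral_poisson hw, integral_sub
    (MemLp.integrable_poisson hw (hF.memLp hε)) (integrable_const _)] at hzero
  have hne : ((Real.pi / w.im : ℝ) : ℂ) ≠ 0 := by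
    rw [Complex.ofReal_ne_zero]
    positivity
  have := (mul_eq_zero.1 hzero).resolve_left hne
  rw [sub_eq_zero] at this
  rw [this]
  simp

/-- Banach–Alaoglu, read through the Riesz isomorphism. With an ultrafilter in place of a
subsequence, no separability is needed. -/
lemma exists_ultrafilter_tendsto_inner {H : Type*} [NormedAddCommGroup H] [InnerProductSpace ℂ H]
    [CompleteSpace H] {x : ℕ → H} {C : ℝ} (hx : ∀ n, ‖x n‖ ≤ C) :
    ∃ (f : H) (U : Ultrafilter ℕ), (U : Filter ℕ) ≤ atTop ∧
      ∀ k, Tendsto (fun n => inner ℂ (x n) k) U (𝓝 (inner ℂ f k)) := by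
  let U : Ultrafilter ℕ := Filter.hyperfilter ℕ
  let φ : ℕ → WeakDual ℂ H := fun n =>
    StrongDual.toWeakDual (InnerProductSpace.toDual ℂ H (x n))
  have hφ : ∀ n, φ n ∈ WeakDual.toStrongDual ⁻¹' Metric.closedBall (0 : StrongDual ℂ H) C := by
    intro n
    have : ‖InnerProductSpace.toDual ℂ H (x n)‖ ≤ C := by
      rw [LinearIsometryEquiv.norm_map]
      exact hx n
    simpa [φ] using this
  obtain ⟨ψ, -, hψ⟩ := (WeakDual.isCompact_closedBall (0 : StrongDual ℂ H) C).ultrafilter_le_nhds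
    (U.map φ) (by
      rw [Ultrafilter.coe_map, le_principal_iff]
      exact mem_map.2 (univ_mem' hφ))
  refine ⟨(InnerProductSpace.toDual ℂ H).symm (WeakDual.toStrongDual ψ), U,
    Nat.hyperfilter_le_atTop, fun k => ?_⟩
  have h1 : Tendsto φ U (𝓝 ψ) := hψ
  have h2 := ((WeakDual.eval_continuous k).tendsto ψ).comp h1
  rw [InnerProductSpace.toDual_symm_apply]
  exact h2

lemma memLp_ofReal_poissonKernel {z : ℂ} (hz : 0 < z.im) :
    MemLp (fun t => (poissonKernel z t : ℂ)) 2 :=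
  (memLp_poissonKernel hz).ofReal

lemma inner_poissonKernel {z : ℂ} (hz : 0 < z.im) (f : Lp ℂ 2 (volume : Measure ℝ)) :
    inner ℂ f ((memLp_ofReal_poissonKernel hz).toLp _) =
      (starRingEnd ℂ) (∫ t, f t ∂poisson z) := by
  rw [L2.inner_def, integral_poisson hz, ← integral_conj]
  refine integral_congr_ae ?_
  filter_upwards [(memLp_ofReal_poissonKernel hz).coeFn_toLp] with t ht
  rw [ht]
  simp

/-- A function of the Hardy space `𝓗²` is the Poisson integral of its boundary function. -/
theorem IsHardy.exists_eq_integral_poisson {F : ℂ → ℂ} (hF : IsHardy 2 F) :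
    ∃ f : Lp ℂ 2 (volume : Measure ℝ), (∀ z ∈ upperHalf, F z = ∫ t, f t ∂poisson z) ∧
      HasBoundaryFunction F f := by
  obtain ⟨hd, C, hC⟩ := id hF
  have hpos : ∀ n : ℕ, (0 : ℝ) < 1 / (n + 1) := fun n => Nat.one_div_pos_of_nat
  -- The boundary function is a weak limit of the traces on the lines `Im = 1 / (n + 1)`. Testing
  -- against the Poisson kernel, which is in `L²`, passes the shifted formula to the limit.
  let x : ℕ → Lp ℂ 2 (volume : Measure ℝ) := fun n => (hF.memLp (hpos n)).toLp _
  have hx : ∀ n, ‖x n‖ ≤ C := fun n => by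
    rw [Lp.norm_toLp]
    exact ENNReal.toReal_le_coe_of_le_coe (hC _ (hpos n))
  obtain ⟨f, U, hU, hf⟩ := exists_ultrafilter_tendsto_inner hx
  have hrep : ∀ z ∈ upperHalf, F z = ∫ t, f t ∂poisson z := by
    intro z hz
    have h1 := hf ((memLp_ofReal_poissonKernel hz).toLp _)
    simp_rw [inner_poissonKernel hz] at h1
    have h2 := (Complex.continuous_conj.tendsto _).comp h1
    simp only [Function.comp_def, Complex.conj_conj] at h2
    have h3 : ∀ n : ℕ, ∫ t, x n t ∂poisson z = F (z + (1 / (n + 1) : ℝ) * Complex.I) := by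
      intro n
      rw [← hF.integral_poisson_shift (hpos n) hz]
      exact integral_congr_ae
        ((poisson_absolutelyContinuous z).ae_le (hF.memLp (hpos n)).coeFn_toLp)
    simp_rw [h3] at h2
    refine tendsto_nhds_unique (Tendsto.mono_left ?_ hU) h2
    have hc : ContinuousAt F z := (hd.differentiableAt (isOpen_upperHalf.mem_nhds hz)).continuousAt
    refine hc.tendsto.comp ?_
    have : Tendsto (fun n : ℕ => z + (((1 / (n + 1) : ℝ)) : ℂ) * Complex.I) atTop
        (𝓝 (z + ((0 : ℝ) : ℂ) * Complex.I)) :=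
      tendsto_const_nhds.add (((Complex.continuous_ofReal.tendsto 0).comp
        tendsto_one_div_add_atTop_nhds_zero_nat).mul_const _)
    simpa using this
  refine ⟨f, hrep, ?_⟩
  filter_upwards [ae_tendsto_integral_poisson
    (MemLp.integrable_poisson (z := Complex.I) (by simp) (Lp.memLp f))] with x hx a ha
  exact (hx a).congr' (eventually_nhdsWithin_of_forall fun z hz => (hrep z hz.1).symm)

lemma neBot_stolzAngle {a : ℝ} (ha : 0 < a) (x : ℝ) : (𝓝[stolzAngle a x] (x : ℂ)).NeBot := by
  have h : Tendsto (fun y : ℝ => (x : ℂ) + y * Complex.I) (𝓝[>] 0) (𝓝[stolzAngle a x] (x : ℂ)) := by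
    refine tendsto_nhdsWithin_iff.2 ⟨?_, eventually_nhdsWithin_of_forall fun y hy => ?_⟩
    · have : Continuous fun y : ℝ => (x : ℂ) + y * Complex.I := by fun_prop
      simpa using (this.tendsto 0).mono_left nhdsWithin_le_nhds
    · have hy' : (0 : ℝ) < y := hy
      exact ⟨by simpa using hy', by simpa using mul_pos ha hy'⟩
  exact h.neBot

lemma HasNontangentialLimit.unique {F : ℂ → ℂ} {x : ℝ} {l l' : ℂ}
    (h : HasNontangentialLimit F x l) (h' : HasNontangentialLimit F x l') : l = l' := by
  have := neBot_stolzAngle one_pos x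
  exact tendsto_nhds_unique (h 1 one_pos) (h' 1 one_pos)

lemma HasBoundaryFunction.ae_eq {F : ℂ → ℂ} {f g : ℝ → ℂ} (hf : HasBoundaryFunction F f)
    (hg : HasBoundaryFunction F g) : f =ᵐ[volume] g := by
  filter_upwards [hf, hg] with x h1 h2 using h1.unique h2

lemma IsHardy.eq_integral_poisson {F : ℂ → ℂ} (hF : IsHardy 2 F) {f : ℝ → ℂ}
    (hf : HasBoundaryFunction F f) {z : ℂ} (hz : z ∈ upperHalf) :
    F z = ∫ t, f t ∂poisson z := by
  obtain ⟨f', h1, h2⟩ := hF.exists_eq_integral_poisson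
  rw [h1 z hz]
  exact integral_congr_ae ((poisson_absolutelyContinuous z).ae_le (h2.ae_eq hf))

lemma IsHardy.memLp_boundary {F : ℂ → ℂ} (hF : IsHardy 2 F) {f : ℝ → ℂ}
    (hf : HasBoundaryFunction F f) : MemLp f 2 := by
  obtain ⟨f', -, h2⟩ := hF.exists_eq_integral_poisson
  exact (memLp_congr_ae (h2.ae_eq hf)).1 (Lp.memLp f')

lemma IsHardy.mul_of_bounded {F A : ℂ → ℂ} (hF : IsHardy 2 F) (hA : DifferentiableOn ℂ A upperHalf)
    {M : ℝ} (hM : ∀ z ∈ upperHalf, ‖A z‖ ≤ M) : IsHardy 2 fun z => A z * F z := by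
  obtain ⟨hd, C, hC⟩ := hF
  refine ⟨hA.mul hd, M.toNNReal * C, fun y hy => ?_⟩
  rw [ENNReal.coe_mul]
  refine (eLpNorm_le_mul_eLpNorm_of_ae_le_mul (c := M)
    (g := fun x : ℝ => F (x + y * Complex.I)) (ae_of_all _ fun x => ?_) 2).trans ?_
  · rw [norm_mul]
    gcongr
    exact hM _ (by simpa [upperHalf] using hy)
  · exact mul_le_mul' le_rfl (hC y hy)

end Representation

/-! ### Cauchy kernels and Cauchy integrals. -/

section CauchyKernel

lemma normSq_ofReal_sub (t : ℝ) (w : ℂ) : ‖(t : ℂ) - w‖ ^ 2 = (t - w.re) ^ 2 + w.im ^ 2 := by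
  rw [← Complex.normSq_eq_norm_sq, Complex.normSq_apply]
  simp
  ring

lemma ofReal_sub_ne_zero {w : ℂ} (hw : w.im ≠ 0) (t : ℝ) : (t : ℂ) - w ≠ 0 := by
  intro h
  have := congrArg Complex.im h
  simp at this
  exact hw this

lemma continuous_inv_ofReal_sub {w : ℂ} (hw : w.im ≠ 0) :
    Continuous fun t : ℝ => ((t : ℂ) - w)⁻¹ :=
  (by fun_prop : Continuous fun t : ℝ => (t : ℂ) - w).inv₀ (ofReal_sub_ne_zero hw)

lemma norm_inv_ofReal_sub_sq {w : ℂ} (hw : w.im ≠ 0) (t : ℝ) :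
    ‖((t : ℂ) - w)⁻¹‖ ^ 2 = Real.pi / |w.im| * poissonKernel ⟨w.re, |w.im|⟩ t := by
  have : 0 < |w.im| := abs_pos.2 hw
  rw [norm_inv, inv_pow, normSq_ofReal_sub]
  simp only [poissonKernel, sq_abs]
  field_simp

lemma poissonKernel_eq_inv_mul_inv {w : ℂ} (hw : 0 < w.im) (t : ℝ) :
    (poissonKernel w t : ℂ) =
      (w.im / Real.pi : ℝ) * (((t : ℂ) - w)⁻¹ * ((t : ℂ) - (starRingEnd ℂ) w)⁻¹) := by
  have h : ((t : ℂ) - w) * ((t : ℂ) - (starRingEnd ℂ) w) =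
      (((t - w.re) ^ 2 + w.im ^ 2 : ℝ) : ℂ) := by
    rw [← normSq_ofReal_sub, ← Complex.normSq_eq_norm_sq, Complex.normSq_eq_conj_mul_self,
      mul_comm]
    simp
  rw [← mul_inv, h, ← Complex.ofReal_inv, ← Complex.ofReal_mul]
  congr 1
  unfold poissonKernel
  field_simp

lemma memLp_inv_ofReal_sub {w : ℂ} (hw : w.im ≠ 0) : MemLp (fun t : ℝ => ((t : ℂ) - w)⁻¹) 2 := by
  rw [memLp_two_iff_integrable_sq_norm (continuous_inv_ofReal_sub hw).aestronglyMeasurable]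
  simp_rw [norm_inv_ofReal_sub_sq hw]
  exact (integrable_poissonKernel (abs_pos.2 hw)).const_mul _

lemma integrable_mul_inv_ofReal_sub {f : ℝ → ℂ} (hf : MemLp f 2) {w : ℂ} (hw : w.im ≠ 0) :
    Integrable fun t : ℝ => f t * ((t : ℂ) - w)⁻¹ :=
  hf.integrable_mul (memLp_inv_ofReal_sub hw)

lemma isHardy_inv_sub_conj {w : ℂ} (hw : 0 < w.im) :
    IsHardy 2 fun z => (z - (starRingEnd ℂ) w)⁻¹ := by
  refine ⟨DifferentiableOn.inv (by fun_prop) fun z hz h => ?_,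
    (Real.sqrt (Real.pi / w.im)).toNNReal, fun y hy => ?_⟩
  · have := congrArg Complex.im h
    have hz' : 0 < z.im := hz
    simp at this
    linarith
  · rw [eLpNorm_two_le_iff]
    have him : ((starRingEnd ℂ) w - y * Complex.I).im ≠ 0 := by
      simp
      linarith
    have hk : ∀ x : ℝ, ‖((x : ℂ) + y * Complex.I - (starRingEnd ℂ) w)⁻¹‖ₑ ^ 2 =
        ENNReal.ofReal (Real.pi / |((starRingEnd ℂ) w - y * Complex.I).im| *
          poissonKernel ⟨((starRingEnd ℂ) w - y * Complex.I).re,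
            |((starRingEnd ℂ) w - y * Complex.I).im|⟩ x) := by
      intro x
      rw [← norm_inv_ofReal_sub_sq him, ENNReal.ofReal_pow (norm_nonneg _), ofReal_norm,
        ← sub_add, sub_add_eq_add_sub]
    simp_rw [hk]
    rw [← ofReal_integral_eq_lintegral_ofReal
      ((integrable_poissonKernel (abs_pos.2 him)).const_mul _)
      (ae_of_all _ fun x => mul_nonneg (by positivity)
        (poissonKernel_pos (abs_pos.2 him) x).le), integral_const_mul,
      integral_poissonKernel (abs_pos.2 him), mul_one]
    show _ ≤ ENNReal.ofReal (Real.sqrt (Real.pi / w.im)) ^ 2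
    rw [← ENNReal.ofReal_pow (Real.sqrt_nonneg _), Real.sq_sqrt (by positivity)]
    refine ENNReal.ofReal_le_ofReal ?_
    gcongr
    simp
    rw [abs_of_neg (by linarith)]
    linarith

lemma hasNontangentialLimit_of_continuousAt {A : ℂ → ℂ} {x : ℝ} (hA : ContinuousAt A (x : ℂ)) :
    HasNontangentialLimit A x (A x) :=
  fun _ _ => hA.tendsto.mono_left nhdsWithin_le_nhds

lemma HasBoundaryFunction.mul {F G : ℂ → ℂ} {f g : ℝ → ℂ} (hf : HasBoundaryFunction F f)
    (hg : HasBoundaryFunction G g) : HasBoundaryFunction (fun z => F z * G z) fun x => f x * g x := by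
  filter_upwards [hf, hg] with x h1 h2 a ha using (h1 a ha).mul (h2 a ha)

lemma sub_conj_ne_zero {v z : ℂ} (hv : 0 < v.im) (hz : 0 ≤ z.im) :
    z - (starRingEnd ℂ) v ≠ 0 := by
  intro h
  have := congrArg Complex.im h
  simp at this
  linarith

/-- The factor `A z = (z - w) / (z - v̄)` is bounded on `ℂ₊` and vanishes at `w`. In the Poisson
formula for `A F` at `w`, the numerator `t - w` cancels one of the two factors of the kernel. -/
lemma IsHardy.integral_mul_inv_mul_inv {F : ℂ → ℂ} (hF : IsHardy 2 F) {f : ℝ → ℂ}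
    (hf : HasBoundaryFunction F f) {w v : ℂ} (hw : 0 < w.im) (hv : 0 < v.im) :
    ∫ t : ℝ, f t * ((t : ℂ) - (starRingEnd ℂ) w)⁻¹ * ((t : ℂ) - (starRingEnd ℂ) v)⁻¹ = 0 := by
  set A : ℂ → ℂ := fun z => (z - w) / (z - (starRingEnd ℂ) v) with hA
  have hAd : DifferentiableOn ℂ A upperHalf :=
    DifferentiableOn.div (by fun_prop) (by fun_prop) fun z hz => sub_conj_ne_zero hv (le_of_lt hz)
  have hAb : ∀ z ∈ upperHalf, ‖A z‖ ≤ 1 + ‖(starRingEnd ℂ) v - w‖ / v.im := by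
    intro z hz
    have hne := sub_conj_ne_zero hv (le_of_lt hz)
    have hz' : 0 < z.im := hz
    have h1 : A z = 1 + ((starRingEnd ℂ) v - w) / (z - (starRingEnd ℂ) v) := by
      simp only [hA]
      field_simp
      ring
    have h2 : v.im ≤ ‖z - (starRingEnd ℂ) v‖ := by
      refine le_trans ?_ (Complex.abs_im_le_norm _)
      simp
      rw [abs_of_pos (by linarith)]
      linarith
    rw [h1]
    refine (norm_add_le _ _).trans ?_
    rw [norm_one, norm_div]
    gcongr
  have hH := hF.mul_of_bounded hAd hAb
  have hHb : HasBoundaryFunction (fun z => A z * F z) fun x => A x * f x :=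
    HasBoundaryFunction.mul (ae_of_all _ fun x => hasNontangentialLimit_of_continuousAt
      (ContinuousAt.div (by fun_prop) (by fun_prop) (sub_conj_ne_zero hv (by simp)))) hf
  have h := hH.eq_integral_poisson hHb (z := w) hw
  rw [integral_poisson hw] at h
  have hpt : ∀ t : ℝ, poissonKernel w t • (A t * f t) = ((w.im / Real.pi : ℝ) : ℂ) *
      (f t * ((t : ℂ) - (starRingEnd ℂ) w)⁻¹ * ((t : ℂ) - (starRingEnd ℂ) v)⁻¹) := by
    intro t
    have h1 : (t : ℂ) - w ≠ 0 := ofReal_sub_ne_zero hw.ne' t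
    rw [Complex.real_smul, poissonKernel_eq_inv_mul_inv hw]
    simp only [hA]
    rw [div_eq_mul_inv]
    field_simp
  simp_rw [hpt] at h
  rw [integral_const_mul] at h
  have hA0 : A w * F w = 0 := by simp [hA]
  rw [hA0] at h
  exact (mul_eq_zero.1 h.symm).resolve_left
    (Complex.ofReal_ne_zero.2 (div_pos hw Real.pi_pos).ne')

/-- Boundary functions of `𝓗²` are orthogonal to the Cauchy kernels of points of `ℂ₊`. -/
lemma IsHardy.integral_mul_inv_eq_zero {F : ℂ → ℂ} (hF : IsHardy 2 F) {f : ℝ → ℂ}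
    (hf : HasBoundaryFunction F f) {w : ℂ} (hw : 0 < w.im) :
    ∫ t : ℝ, f t * ((t : ℂ) - (starRingEnd ℂ) w)⁻¹ = 0 := by
  have hw' : ((starRingEnd ℂ) w).im ≠ 0 := by simpa using hw.ne'
  have hi := integrable_mul_inv_ofReal_sub (hF.memLp_boundary hf) hw'
  -- The second Cauchy factor is taken at `v = (n + 1) i` and rescaled to have modulus at most `1`
  -- and limit `1`; dominated convergence then removes it.
  have hzero : ∀ n : ℕ, ∫ t : ℝ, f t * ((t : ℂ) - (starRingEnd ℂ) w)⁻¹ *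
      ((t : ℂ) / ((n : ℂ) + 1) * -Complex.I + 1)⁻¹ = 0 := by
    intro n
    have hv : 0 < (((n + 1 : ℝ) : ℂ) * Complex.I).im := by
      simp
      positivity
    have h := hF.integral_mul_inv_mul_inv hf hw hv
    have hn : (n : ℂ) + 1 ≠ 0 := Nat.cast_add_one_ne_zero n
    have hpt : ∀ t : ℝ, f t * ((t : ℂ) - (starRingEnd ℂ) w)⁻¹ *
        ((t : ℂ) / ((n : ℂ) + 1) * -Complex.I + 1)⁻¹ = f t * ((t : ℂ) - (starRingEnd ℂ) w)⁻¹ *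
        ((t : ℂ) - (starRingEnd ℂ) (((n + 1 : ℝ) : ℂ) * Complex.I))⁻¹ *
          (((n : ℂ) + 1) * Complex.I) := by
      intro t
      have h1 : (t : ℂ) - (starRingEnd ℂ) (((n + 1 : ℝ) : ℂ) * Complex.I) =
          ((t : ℂ) / ((n : ℂ) + 1) * -Complex.I + 1) * (((n : ℂ) + 1) * Complex.I) := by
        simp
        field_simp
        ring_nf
        simp
      rw [h1, mul_inv, mul_assoc _ (_ * _) (_ * Complex.I), mul_assoc _⁻¹ _⁻¹, inv_mul_cancel₀
        (mul_ne_zero hn Complex.I_ne_zero), mul_one]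
    simp_rw [hpt]
    rw [integral_mul_const, h, zero_mul]
  have hden : ∀ (n : ℕ) (t : ℝ), 1 ≤ ‖(t : ℂ) / ((n : ℂ) + 1) * -Complex.I + 1‖ := by
    intro n t
    refine le_trans ?_ (Complex.abs_re_le_norm _)
    have : (t : ℂ) / ((n : ℂ) + 1) = ((t / (n + 1) : ℝ) : ℂ) := by push_cast; rfl
    rw [this]
    simp only [Complex.add_re, Complex.mul_re, Complex.neg_re, Complex.I_re, Complex.ofReal_re,
      Complex.ofReal_im, Complex.neg_im, Complex.I_im, Complex.one_re]
    norm_num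
  have hlim := tendsto_integral_of_dominated_convergence
    (F := fun (n : ℕ) (t : ℝ) => f t * ((t : ℂ) - (starRingEnd ℂ) w)⁻¹ *
      ((t : ℂ) / ((n : ℂ) + 1) * -Complex.I + 1)⁻¹)
    (f := fun t : ℝ => f t * ((t : ℂ) - (starRingEnd ℂ) w)⁻¹)
    (fun t => ‖f t * ((t : ℂ) - (starRingEnd ℂ) w)⁻¹‖) (μ := volume)
    (fun n => hi.1.mul (Continuous.aestronglyMeasurable (Continuous.inv₀ (by fun_prop)
      fun t => norm_pos_iff.1 (one_pos.trans_le (hden n t))))) hi.norm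
    (fun n => ae_of_all _ fun t => by
      rw [norm_mul, norm_inv]
      exact mul_le_of_le_one_right (norm_nonneg _) (inv_le_one_of_one_le₀ (hden n t)))
    (ae_of_all _ fun t => by
      have h1 : Tendsto (fun n : ℕ => (t : ℂ) / ((n : ℂ) + 1)) atTop (𝓝 0) := by
        have : Tendsto (fun n : ℕ => ((t * (1 / ((n : ℝ) + 1)) : ℝ) : ℂ)) atTop
            (𝓝 ((t * 0 : ℝ) : ℂ)) :=
          (Complex.continuous_ofReal.tendsto _).comp
            (tendsto_one_div_add_atTop_nhds_zero_nat.const_mul t)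
        simpa [div_eq_mul_inv] using this
      have h2 := (((h1.mul_const (-Complex.I)).add_const 1).inv₀ (by simp)).const_mul
        (f t * ((t : ℂ) - (starRingEnd ℂ) w)⁻¹)
      simpa using h2)
  simp_rw [hzero] at hlim
  exact (tendsto_nhds_unique hlim tendsto_const_nhds)

/-- Integrals of Cauchy type, with a regularizing summand `c`, are holomorphic. -/
lemma differentiableOn_integral_cauchy {u c : ℝ → ℂ} (hu : Integrable u (poisson Complex.I))
    (hi : ∀ z ∈ upperHalf, Integrable fun t : ℝ => u t * (((t : ℂ) - z)⁻¹ - c t)) :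
    DifferentiableOn ℂ (fun z => ∫ t : ℝ, u t * (((t : ℂ) - z)⁻¹ - c t)) upperHalf := by
  intro z₀ hz₀
  have hz₀' : 0 < z₀.im := hz₀
  have him : ∀ z ∈ Metric.ball z₀ (z₀.im / 2), 0 < z.im := by
    intro z hz
    have h1 := (Complex.abs_im_le_norm (z - z₀)).trans_lt (mem_ball_iff_norm.1 hz)
    rw [Complex.sub_im, abs_lt] at h1
    linarith [h1.1]
  have hum : AEStronglyMeasurable u volume :=
    hu.1.mono_ac (absolutelyContinuous_poisson (by simp))
  have hui := Integrable.poisson hu (by simp) hz₀'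
  rw [integrable_poisson_iff hz₀'] at hui
  refine (hasDerivAt_integral_of_dominated_loc_of_deriv_le (𝕜 := ℂ) (μ := volume)
    (F := fun z t => u t * (((t : ℂ) - z)⁻¹ - c t))
    (F' := fun z t => u t * (((t : ℂ) - z) ^ 2)⁻¹)
    (bound := fun t => 4 * (Real.pi / z₀.im) * ‖poissonKernel z₀ t • u t‖)
    (Metric.ball_mem_nhds z₀ (half_pos hz₀'))
    ?_ (hi z₀ hz₀) ?_ ?_ (hui.norm.const_mul _) ?_).2.differentiableAt.differentiableWithinAt
  · filter_upwards [Metric.ball_mem_nhds z₀ (half_pos hz₀')] with z hz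
    exact (hi z (him z hz)).1
  · refine hum.mul (Continuous.aestronglyMeasurable (Continuous.inv₀ (by fun_prop) fun t => ?_))
    exact pow_ne_zero _ (ofReal_sub_ne_zero hz₀'.ne' t)
  · refine ae_of_all _ fun t z hz => ?_
    have h1 := mem_ball_iff_norm.1 hz
    have h2 : z₀.im ≤ ‖(t : ℂ) - z₀‖ := by
      refine le_trans ?_ (Complex.abs_im_le_norm _)
      simp [abs_of_pos hz₀']
    have h3 : ‖(t : ℂ) - z₀‖ / 2 ≤ ‖(t : ℂ) - z‖ := by
      have : ‖(t : ℂ) - z₀‖ ≤ ‖(t : ℂ) - z‖ + ‖z - z₀‖ :=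
        norm_sub_le_norm_sub_add_norm_sub _ _ _
      linarith
    have h4 : 0 < ‖(t : ℂ) - z₀‖ := hz₀'.trans_le h2
    have h5 : (‖(t : ℂ) - z‖ ^ 2)⁻¹ ≤ 4 * (Real.pi / z₀.im) * poissonKernel z₀ t := by
      have : 4 * (Real.pi / z₀.im) * poissonKernel z₀ t = ((‖(t : ℂ) - z₀‖ / 2) ^ 2)⁻¹ := by
        rw [div_pow, normSq_ofReal_sub]
        unfold poissonKernel
        field_simp
        norm_num
      rw [this]
      gcongr
    rw [norm_mul, norm_inv, norm_pow, norm_smul, Real.norm_of_nonneg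
      (poissonKernel_pos hz₀' t).le, ← mul_assoc, mul_comm]
    gcongr
  · refine ae_of_all _ fun t z hz => ?_
    have hne := ofReal_sub_ne_zero (him z hz).ne' t
    have h1 : HasDerivAt (fun z : ℂ => (t : ℂ) - z) (-1) z := by
      simpa using (hasDerivAt_id z).const_sub (t : ℂ)
    have h2 : HasDerivAt (fun z : ℂ => u t * (((t : ℂ) - z)⁻¹ - c t))
        (u t * (-(-1) / ((t : ℂ) - z) ^ 2)) z :=
      ((h1.inv hne).sub_const (c t)).const_mul (u t)
    rwa [neg_neg, one_div] at h2

end CauchyKernel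

/-! ### The orthogonal complement of `𝓗²₊`. -/

section Orthogonality

lemma HasBoundaryFunction.congr {F : ℂ → ℂ} {f g : ℝ → ℂ} (hf : HasBoundaryFunction F f)
    (h : f =ᵐ[volume] g) : HasBoundaryFunction F g := by
  filter_upwards [hf, h] with x h1 h2
  rwa [← h2]

lemma isHardy_integral_poisson {f : ℝ → ℂ} (hf : MemLp f 2)
    (hd : DifferentiableOn ℂ (fun z => ∫ t, f t ∂poisson z) upperHalf) :
    IsHardy 2 fun z => ∫ t, f t ∂poisson z := by
  refine isHardy_two_of_enorm_le hd hf.1.enorm ?_ fun z _ => enorm_integral_le_lintegral_enorm _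
  have := hf.2
  rw [eLpNorm_lt_top_iff_lintegral_rpow_enorm_lt_top (by simp) (by simp)] at this
  simpa using this

/-- The Cauchy kernel `t ↦ 1 / (t - w)` as an element of `L²(ℝ)`. -/
def cauchyVec (w : ℂ) (hw : w.im ≠ 0) : Lp ℂ 2 (volume : Measure ℝ) :=
  (memLp_inv_ofReal_sub hw).toLp _

lemma conj_im_ne_zero {w : ℂ} (hw : w.im ≠ 0) : ((starRingEnd ℂ) w).im ≠ 0 := by
  simpa using hw

lemma inner_cauchyVec {w : ℂ} (hw : w.im ≠ 0) (f : Lp ℂ 2 (volume : Measure ℝ)) :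
    inner ℂ (cauchyVec w hw) f = ∫ t : ℝ, f t * ((t : ℂ) - (starRingEnd ℂ) w)⁻¹ := by
  rw [L2.inner_def]
  refine integral_congr_ae ?_
  filter_upwards [(memLp_inv_ofReal_sub hw).coeFn_toLp] with t ht
  rw [cauchyVec, ht]
  simp

lemma integral_poisson_eq_cauchy {f : ℝ → ℂ} (hf : MemLp f 2) {w : ℂ} (hw : 0 < w.im) :
    ∫ t, f t ∂poisson w = (2 * Real.pi * Complex.I)⁻¹ * ((∫ t : ℝ, f t * ((t : ℂ) - w)⁻¹) -
      ∫ t : ℝ, f t * ((t : ℂ) - (starRingEnd ℂ) w)⁻¹) := by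
  rw [integral_poisson hw, ← integral_sub (integrable_mul_inv_ofReal_sub hf hw.ne')
    (integrable_mul_inv_ofReal_sub hf (conj_im_ne_zero hw.ne')), ← integral_const_mul]
  refine integral_congr_ae (ae_of_all _ fun t => ?_)
  have h1 := ofReal_sub_ne_zero hw.ne' t
  have h2 := ofReal_sub_ne_zero (conj_im_ne_zero hw.ne') t
  have h3 : (w - (starRingEnd ℂ) w) = 2 * w.im * Complex.I := by
    rw [Complex.sub_conj]
    push_cast
    ring
  have hpi : (Real.pi : ℂ) ≠ 0 := Complex.ofReal_ne_zero.2 Real.pi_ne_zero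
  have h4 : ((t : ℂ) - w)⁻¹ - ((t : ℂ) - (starRingEnd ℂ) w)⁻¹ =
      2 * w.im * Complex.I * (((t : ℂ) - w)⁻¹ * ((t : ℂ) - (starRingEnd ℂ) w)⁻¹) := by
    rw [← h3]
    field_simp
    ring
  simp only [Complex.real_smul]
  rw [poissonKernel_eq_inv_mul_inv hw, ← mul_sub, h4]
  push_cast
  field_simp

/-- For the converse, the Poisson kernel is a difference of two Cauchy kernels. Orthogonality kills
the antiholomorphic one, so the Poisson integral of `f` is a Cauchy integral, hence holomorphic, and
Fatou's theorem returns `f` on the boundary. -/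
lemma mem_hardy_two_iff {f : Lp ℂ 2 (volume : Measure ℝ)} :
    f ∈ hardy 2 ↔ ∀ (w : ℂ) (hw : 0 < w.im), inner ℂ (cauchyVec w hw.ne') f = 0 := by
  simp_rw [inner_cauchyVec]
  constructor
  · rintro ⟨F, hF, hFf⟩ w hw
    exact hF.integral_mul_inv_eq_zero hFf hw
  · intro h
    have hf := Lp.memLp f
    have hfI : Integrable f (poisson Complex.I) := MemLp.integrable_poisson (by simp) hf
    have hd : DifferentiableOn ℂ (fun z => ∫ t, f t ∂poisson z) upperHalf := by
      have h0 := differentiableOn_integral_cauchy (c := 0) hfI fun z hz => by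
        simpa using integrable_mul_inv_ofReal_sub hf (ne_of_gt hz)
      refine (h0.const_mul (2 * Real.pi * Complex.I)⁻¹).congr fun z hz => ?_
      rw [integral_poisson_eq_cauchy hf hz, h z hz]
      simp
    refine ⟨_, isHardy_integral_poisson hf hd, ?_⟩
    filter_upwards [ae_tendsto_integral_poisson hfI] with x hx a _ using hx a

lemma cauchyVec_conj_mem_hardy {w : ℂ} (hw : 0 < w.im) :
    cauchyVec ((starRingEnd ℂ) w) (conj_im_ne_zero hw.ne') ∈ hardy 2 := by
  refine ⟨_, isHardy_inv_sub_conj hw, HasBoundaryFunction.congr (ae_of_all _ fun x =>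
    hasNontangentialLimit_of_continuousAt ?_)
      (memLp_inv_ofReal_sub (conj_im_ne_zero hw.ne')).coeFn_toLp.symm⟩
  exact ContinuousAt.inv₀ (by fun_prop) (sub_conj_ne_zero hw (by simp))

/-- The Cauchy kernels of all non-real points are total in `L²(ℝ)`. -/
lemma eq_zero_of_inner_cauchyVec {f : Lp ℂ 2 (volume : Measure ℝ)}
    (h : ∀ (w : ℂ) (hw : w.im ≠ 0), inner ℂ (cauchyVec w hw) f = 0) : f = 0 := by
  have hf := Lp.memLp f
  have hP : ∀ z ∈ upperHalf, ∫ t, f t ∂poisson z = 0 := by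
    intro z hz
    have hz' : 0 < z.im := hz
    have h1 := h z hz'.ne'
    have h2 := h _ (conj_im_ne_zero hz'.ne')
    rw [inner_cauchyVec] at h1 h2
    rw [Complex.conj_conj] at h2
    rw [integral_poisson_eq_cauchy hf hz, h1, h2, sub_zero, mul_zero]
  refine Lp.ext ?_
  filter_upwards [ae_tendsto_integral_poisson (MemLp.integrable_poisson (z := Complex.I)
    (by simp) hf), Lp.coeFn_zero ℂ 2 (volume : Measure ℝ)] with x hx h0
  rw [h0]
  have hn := neBot_stolzAngle one_pos x
  refine tendsto_nhds_unique (hx 1) (Tendsto.congr' ?_ tendsto_const_nhds)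
  exact eventually_nhdsWithin_of_forall fun z hz => (hP z hz.1).symm

lemma inner_cauchyVec_star {w : ℂ} (hw : w.im ≠ 0) (f : Lp ℂ 2 (volume : Measure ℝ)) :
    inner ℂ (cauchyVec w hw) (star f) =
      (starRingEnd ℂ) (inner ℂ (cauchyVec ((starRingEnd ℂ) w) (conj_im_ne_zero hw)) f) := by
  rw [inner_cauchyVec, inner_cauchyVec, ← integral_conj]
  refine integral_congr_ae ?_
  filter_upwards [Lp.coeFn_star f] with t ht
  rw [ht]
  simp

/-- The orthogonal complement of `𝓗²₊` in `L²(ℝ)` is the space of complex conjugates of the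
elements of `𝓗²₊`. -/
theorem mem_hardy_two_orthogonal_iff {f : Lp ℂ 2 (volume : Measure ℝ)} :
    f ∈ (hardy 2)ᗮ ↔ star f ∈ hardy 2 := by
  have hstar : star f ∈ hardy 2 ↔ ∀ (w : ℂ) (hw : 0 < w.im),
      inner ℂ (cauchyVec ((starRingEnd ℂ) w) (conj_im_ne_zero hw.ne')) f = 0 := by
    simp_rw [mem_hardy_two_iff, inner_cauchyVec_star, map_eq_zero]
  rw [hstar]
  constructor
  · intro h w hw
    exact h _ (cauchyVec_conj_mem_hardy hw)
  · intro h g hg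
    set S : Submodule ℂ (Lp ℂ 2 (volume : Measure ℝ)) := Submodule.span ℂ
      (Set.range fun w : {w : ℂ // 0 < w.im} =>
        cauchyVec ((starRingEnd ℂ) (w : ℂ)) (conj_im_ne_zero w.2.ne')) with hS
    have hmem : ∀ (w : ℂ) (hw : 0 < w.im),
        cauchyVec ((starRingEnd ℂ) w) (conj_im_ne_zero hw.ne') ∈ S := fun w hw =>
      Submodule.subset_span ⟨⟨w, hw⟩, rfl⟩
    have hSle : S ≤ hardy 2 := Submodule.span_le.2 <| by
      rintro _ ⟨w, rfl⟩
      exact cauchyVec_conj_mem_hardy w.2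
    have hfS : f ∈ Sᗮ := by
      rw [Submodule.mem_orthogonal]
      intro s hs
      induction hs using Submodule.span_induction with
      | mem x hx =>
        obtain ⟨w, rfl⟩ := hx
        exact h w w.2
      | zero => simp
      | add x y _ _ hx hy => rw [inner_add_left, hx, hy, add_zero]
      | smul c x _ hx => rw [inner_smul_left, hx, mul_zero]
    -- This is the density of `S` in `𝓗²₊`. The component `p` of `g` in `Sᗮ` is orthogonal to the
    -- kernels with pole in the lower half-plane by definition. It is orthogonal to those with pole
    -- in the upper one because `g` is, being in `𝓗²₊`, and `r` is, such kernels lying in `Sᗮ`.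
    -- Totality gives `p = 0`.
    have hgS : g ∈ Sᗮᗮ := by
      obtain ⟨p, hp, r, hr, hgpr⟩ := Sᗮ.exists_add_mem_mem_orthogonal g
      have hp0 : p = 0 := by
        refine eq_zero_of_inner_cauchyVec fun w hw => ?_
        rcases lt_or_gt_of_ne hw with hneg | hpos
        · have := (Submodule.mem_orthogonal _ _).1 hp _ (hmem ((starRingEnd ℂ) w) (by simpa using hneg))
          simpa using this
        · have h1 := mem_hardy_two_iff.1 hg w hpos
          have h2 : inner ℂ (cauchyVec w hw) r = 0 := by
            have hwS : cauchyVec w hw ∈ Sᗮ := (Submodule.mem_orthogonal' _ _).2 fun s hs =>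
              mem_hardy_two_iff.1 (hSle hs) w hpos
            exact (Submodule.mem_orthogonal _ _).1 hr _ hwS
          rwa [hgpr, inner_add_right, h2, add_zero] at h1
      rw [hgpr, hp0, zero_add]
      exact hr
    exact Submodule.inner_left_of_mem_orthogonal hfS hgS

end Orthogonality

/-! ### Outer functions. -/

section Outer

/-- The outer function of `ℂ₊` whose modulus on the boundary is `exp u`. -/
def outer (u : ℝ → ℝ) (z : ℂ) : ℂ :=
  Complex.exp (1 / ((Real.pi : ℂ) * Complex.I) *
    ∫ t : ℝ, (1 / ((t : ℂ) - z) - (t : ℂ) / (1 + (t : ℂ) ^ 2)) * (u t : ℂ))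

lemma one_add_ofReal_sq_ne_zero (t : ℝ) : (1 : ℂ) + (t : ℂ) ^ 2 ≠ 0 := by
  have : (1 : ℂ) + (t : ℂ) ^ 2 = ((1 + t ^ 2 : ℝ) : ℂ) := by push_cast; rfl
  rw [this, Complex.ofReal_ne_zero]
  positivity

/-- Since `t / (1 + t²)` is the mean of `1 / (t - i)` and `1 / (t + i)`, partial fractions give
products of two Cauchy kernels, and the arithmetic-geometric mean inequality bounds these by Poisson
kernels. -/
lemma norm_outer_kernel_le {z : ℂ} (hz : 0 < z.im) (t : ℝ) :
    ‖1 / ((t : ℂ) - z) - (t : ℂ) / (1 + (t : ℂ) ^ 2)‖ ≤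
      (‖z - Complex.I‖ + ‖z + Complex.I‖) / 4 *
        (Real.pi / z.im * poissonKernel z t + Real.pi * poissonKernel Complex.I t) := by
  have hI : (Complex.I).im ≠ 0 := by simp
  have hI' : (-Complex.I).im ≠ 0 := by simp
  have h1 := ofReal_sub_ne_zero hz.ne' t
  have h2 := ofReal_sub_ne_zero hI t
  have h3 := ofReal_sub_ne_zero hI' t
  have h0 := one_add_ofReal_sq_ne_zero t
  have hsplit : 1 / ((t : ℂ) - z) - (t : ℂ) / (1 + (t : ℂ) ^ 2) =
      (z - Complex.I) / 2 * (((t : ℂ) - z)⁻¹ * ((t : ℂ) - Complex.I)⁻¹) +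
      (z + Complex.I) / 2 * (((t : ℂ) - z)⁻¹ * ((t : ℂ) - -Complex.I)⁻¹) := by
    have : (1 : ℂ) + (t : ℂ) ^ 2 = ((t : ℂ) - Complex.I) * ((t : ℂ) - -Complex.I) := by
      ring_nf
      simp
      ring
    rw [this]
    field_simp
    ring
  have n1 : ‖((t : ℂ) - z)⁻¹‖ ^ 2 = Real.pi / z.im * poissonKernel z t := by
    rw [norm_inv_ofReal_sub_sq hz.ne', abs_of_pos hz]
  have n2 : ‖((t : ℂ) - Complex.I)⁻¹‖ ^ 2 = Real.pi * poissonKernel Complex.I t := by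
    rw [norm_inv_ofReal_sub_sq hI]
    simp [poissonKernel]
  have n3 : ‖((t : ℂ) - -Complex.I)⁻¹‖ ^ 2 = Real.pi * poissonKernel Complex.I t := by
    rw [norm_inv_ofReal_sub_sq hI']
    simp [poissonKernel]
  rw [hsplit, ← n1]
  refine (norm_add_le _ _).trans ?_
  rw [norm_mul, norm_mul, norm_mul, norm_mul, norm_div, norm_div, Complex.norm_ofNat]
  have b1 : ‖((t : ℂ) - z)⁻¹‖ * ‖((t : ℂ) - Complex.I)⁻¹‖ ≤
      (‖((t : ℂ) - z)⁻¹‖ ^ 2 + Real.pi * poissonKernel Complex.I t) / 2 := by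
    rw [← n2]
    linarith [two_mul_le_add_sq ‖((t : ℂ) - z)⁻¹‖ ‖((t : ℂ) - Complex.I)⁻¹‖]
  have b2 : ‖((t : ℂ) - z)⁻¹‖ * ‖((t : ℂ) - -Complex.I)⁻¹‖ ≤
      (‖((t : ℂ) - z)⁻¹‖ ^ 2 + Real.pi * poissonKernel Complex.I t) / 2 := by
    rw [← n3]
    linarith [two_mul_le_add_sq ‖((t : ℂ) - z)⁻¹‖ ‖((t : ℂ) - -Complex.I)⁻¹‖]
  have := mul_le_mul_of_nonneg_left b1 (by positivity : 0 ≤ ‖z - Complex.I‖ / 2)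
  have := mul_le_mul_of_nonneg_left b2 (by positivity : 0 ≤ ‖z + Complex.I‖ / 2)
  linarith

variable {u v : ℝ → ℝ}

lemma integrable_outer_kernel_mul (hu : Integrable u (poisson Complex.I)) {z : ℂ}
    (hz : 0 < z.im) :
    Integrable fun t : ℝ => (1 / ((t : ℂ) - z) - (t : ℂ) / (1 + (t : ℂ) ^ 2)) * (u t : ℂ) := by
  have hI : 0 < Complex.I.im := by simp
  have hum : AEStronglyMeasurable u volume := hu.1.mono_ac (absolutelyContinuous_poisson hI)
  have h1 := ((integrable_poisson_iff hz).1 (Integrable.poisson hu hI hz)).norm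
  have h2 := ((integrable_poisson_iff hI).1 hu).norm
  refine (((h1.const_mul (Real.pi / z.im)).add (h2.const_mul Real.pi)).const_mul
    ((‖z - Complex.I‖ + ‖z + Complex.I‖) / 4)).mono' ?_ (ae_of_all _ fun t => ?_)
  · refine AEStronglyMeasurable.mul (Continuous.aestronglyMeasurable ?_)
      (Complex.continuous_ofReal.comp_aestronglyMeasurable hum)
    refine Continuous.sub (continuous_const.div (by fun_prop) (ofReal_sub_ne_zero hz.ne'))
      (Complex.continuous_ofReal.div (by fun_prop) one_add_ofReal_sq_ne_zero)
  · rw [norm_mul, Complex.norm_real]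
    refine (mul_le_mul_of_nonneg_right (norm_outer_kernel_le hz t) (norm_nonneg _)).trans
      (le_of_eq ?_)
    simp only [Pi.add_apply, norm_smul, Real.norm_of_nonneg (poissonKernel_pos hz t).le,
      Real.norm_of_nonneg (poissonKernel_pos hI t).le]
    ring

lemma differentiableOn_outer (hu : Integrable u (poisson Complex.I)) :
    DifferentiableOn ℂ (outer u) upperHalf := by
  have heq : ∀ z : ℂ, ∀ t : ℝ, (1 / ((t : ℂ) - z) - (t : ℂ) / (1 + (t : ℂ) ^ 2)) * (u t : ℂ) =
      (u t : ℂ) * (((t : ℂ) - z)⁻¹ - (t : ℂ) / (1 + (t : ℂ) ^ 2)) := fun z t => by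
    rw [one_div, mul_comm]
  have h := differentiableOn_integral_cauchy (c := fun t => (t : ℂ) / (1 + (t : ℂ) ^ 2))
    hu.ofReal (fun z hz =>
      (integrable_outer_kernel_mul hu hz).congr (ae_of_all _ fun t => heq z t))
  unfold outer
  simp_rw [heq]
  exact (h.const_mul _).cexp

/-- The imaginary part of `1 / (t - z)` is `π` times the Poisson kernel; the real regularizing term
affects only the argument. -/
lemma norm_outer (hu : Integrable u (poisson Complex.I)) {z : ℂ} (hz : 0 < z.im) :
    ‖outer u z‖ = Real.exp (∫ t, u t ∂poisson z) := by
  have hI := integrable_outer_kernel_mul hu hz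
  rw [outer, Complex.norm_exp]
  congr 1
  have h1 : ∀ w : ℂ, (1 / ((Real.pi : ℂ) * Complex.I) * w).re = Real.pi⁻¹ * w.im := by
    intro w
    have : 1 / ((Real.pi : ℂ) * Complex.I) = ((Real.pi⁻¹ : ℝ) : ℂ) * -Complex.I := by
      rw [one_div, mul_inv, Complex.inv_I]
      push_cast
      rfl
    rw [this, mul_assoc, Complex.re_ofReal_mul]
    simp
  rw [h1, ← Complex.imCLM_apply, ← Complex.imCLM.integral_comp_comm hI, integral_poisson hz,
    ← integral_const_mul]
  refine integral_congr_ae (ae_of_all _ fun t => ?_)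
  simp only [Complex.imCLM_apply, smul_eq_mul]
  rw [mul_comm _ (u t : ℂ), Complex.im_ofReal_mul, Complex.sub_im]
  have h2 : ((t : ℂ) / (1 + (t : ℂ) ^ 2)).im = 0 := by
    have : (t : ℂ) / (1 + (t : ℂ) ^ 2) = ((t / (1 + t ^ 2) : ℝ) : ℂ) := by push_cast; rfl
    rw [this, Complex.ofReal_im]
  have h3 : (1 / ((t : ℂ) - z)).im = Real.pi * poissonKernel z t := by
    rw [one_div, Complex.inv_im, Complex.normSq_eq_norm_sq, normSq_ofReal_sub]
    simp only [poissonKernel, Complex.sub_im, Complex.ofReal_im]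
    have : (t - z.re) ^ 2 + z.im ^ 2 ≠ 0 := by positivity
    field_simp
    ring
  rw [h2, h3]
  field_simp
  ring

lemma outer_ne_zero (u : ℝ → ℝ) (z : ℂ) : outer u z ≠ 0 := Complex.exp_ne_zero _

lemma outer_sub (hu : Integrable u (poisson Complex.I)) (hv : Integrable v (poisson Complex.I))
    {z : ℂ} (hz : 0 < z.im) : outer (fun t => u t - v t) z = outer u z / outer v z := by
  simp only [outer]
  rw [← Complex.exp_sub, ← mul_sub, ← integral_sub (integrable_outer_kernel_mul hu hz)
    (integrable_outer_kernel_mul hv hz)]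
  simp only [Complex.ofReal_sub, mul_sub]

lemma isOuter_outer (hu : Integrable u (poisson Complex.I)) : IsOuter (outer u) :=
  ⟨u, integrable_poisson_I_iff.1 hu, fun _ _ => rfl⟩

lemma IsOuter.exists_eq_outer {F : ℂ → ℂ} (hF : IsOuter F) :
    ∃ u : ℝ → ℝ, Integrable u (poisson Complex.I) ∧ ∀ z ∈ upperHalf, F z = outer u z := by
  obtain ⟨u, hu, h⟩ := hF
  exact ⟨u, integrable_poisson_I_iff.2 hu, h⟩

lemma ae_tendsto_norm_outer (hu : Integrable u (poisson Complex.I)) :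
    ∀ᵐ x : ℝ, ∀ a : ℝ, Tendsto (fun z => ‖outer u z‖) (𝓝[stolzAngle a x] (x : ℂ))
      (𝓝 (Real.exp (u x))) := by
  filter_upwards [ae_tendsto_integral_poisson hu] with x hx a
  refine ((Real.continuous_exp.tendsto _).comp (hx a)).congr'
    (eventually_nhdsWithin_of_forall fun z hz => (norm_outer hu hz.1).symm)

lemma exp_integral_poisson_le {z : ℂ} (hz : 0 < z.im) (hu : Integrable u (poisson z))
    (he : Integrable (fun t => Real.exp (u t)) (poisson z)) :
    Real.exp (∫ t, u t ∂poisson z) ≤ ∫ t, Real.exp (u t) ∂poisson z := by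
  have := isProbabilityMeasure_poisson hz
  exact convexOn_exp.map_integral_le Real.continuous_exp.continuousOn isClosed_univ
    (ae_of_all _ fun _ => Set.mem_univ _) hu he

end Outer

/-! ### The Smirnov maximum principle and log-integrability. -/

section Jensen

lemma isHardy_two_of_norm_le_integral {F : ℂ → ℂ} (hF : DifferentiableOn ℂ F upperHalf)
    {m : ℝ → ℝ} (hm : MemLp m 2) (h : ∀ z ∈ upperHalf, ‖F z‖ ≤ ∫ t, m t ∂poisson z) :
    IsHardy 2 F := by
  refine isHardy_two_of_enorm_le hF hm.1.enorm ?_ fun z hz => ?_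
  · have := hm.2
    rw [eLpNorm_lt_top_iff_lintegral_rpow_enorm_lt_top (by simp) (by simp)] at this
    simpa using this
  · refine le_trans ?_ (enorm_integral_le_lintegral_enorm _)
    rw [← ofReal_norm, ← ofReal_norm]
    exact ENNReal.ofReal_le_ofReal ((h z hz).trans (le_abs_self _))

/-- A form of the Smirnov maximum principle: if the boundary function of `Ψ ∈ 𝓗²` is bounded by
`m * exp u`, then `Ψ` is bounded by the Poisson integral of `m` times the exponential of the
Poisson integral of `u`. -/
theorem IsHardy.norm_le_exp_mul_integral {Ψ : ℂ → ℂ} (hΨ : IsHardy 2 Ψ) {ψ : ℝ → ℂ}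
    (hψ : HasBoundaryFunction Ψ ψ) {u m : ℝ → ℝ} (hu : Integrable u (poisson Complex.I))
    (hm : Integrable m (poisson Complex.I)) (h : ∀ᵐ x, ‖ψ x‖ ≤ m x * Real.exp (u x))
    {z : ℂ} (hz : z ∈ upperHalf) :
    ‖Ψ z‖ ≤ Real.exp (∫ t, u t ∂poisson z) * ∫ t, m t ∂poisson z := by
  have hI : 0 < Complex.I.im := by simp
  have hz' : 0 < z.im := hz
  -- Truncation from below bounds `1 / outer (un n)` by `exp n`, so that `Ψ / outer (un n)` stays in
  -- `𝓗²` and has a Poisson representation. The truncation is removed at the end by dominated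
  -- convergence.
  set un : ℕ → ℝ → ℝ := fun n t => max (u t) (-n) with hun
  have hPI := isProbabilityMeasure_poisson hI
  have hunI : ∀ n, Integrable (un n) (poisson Complex.I) := fun n => hu.sup (integrable_const _)
  have hbd : ∀ n, ‖Ψ z‖ ≤ Real.exp (∫ t, un n t ∂poisson z) * ∫ t, m t ∂poisson z := by
    intro n
    have hAd : DifferentiableOn ℂ (fun z => (outer (un n) z)⁻¹) upperHalf :=
      (differentiableOn_outer (hunI n)).inv fun z _ => outer_ne_zero _ _
    have hAb : ∀ w ∈ upperHalf, ‖(outer (un n) w)⁻¹‖ ≤ Real.exp n := by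
      intro w hw
      have hw' : 0 < w.im := hw
      have := isProbabilityMeasure_poisson hw'
      rw [norm_inv, norm_outer (hunI n) hw', ← Real.exp_neg]
      refine Real.exp_le_exp.2 ?_
      have h1 : ∫ t, (-n : ℝ) ∂poisson w ≤ ∫ t, un n t ∂poisson w :=
        integral_mono (integrable_const _) (Integrable.poisson (hunI n) hI hw')
          fun t => le_max_right _ _
      simp only [integral_const, probReal_univ, one_smul] at h1
      linarith
    obtain ⟨b, hb, hbb⟩ := (hΨ.mul_of_bounded hAd hAb).exists_eq_integral_poisson
    have hbm : ∀ᵐ x, ‖b x‖ ≤ m x := by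
      filter_upwards [hbb, hψ, ae_tendsto_norm_outer (hunI n), h] with x h1 h2 h3 h4
      have hn := neBot_stolzAngle one_pos x
      have h5 : Tendsto (fun z => ‖(outer (un n) z)⁻¹ * Ψ z‖) (𝓝[stolzAngle 1 x] (x : ℂ))
          (𝓝 ((Real.exp (un n x))⁻¹ * ‖ψ x‖)) := by
        simp_rw [norm_mul, norm_inv]
        exact ((h3 1).inv₀ (Real.exp_pos _).ne').mul (h2 1 one_pos).norm
      rw [tendsto_nhds_unique (h1 1 one_pos).norm h5, inv_mul_le_iff₀ (Real.exp_pos _), mul_comm]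
      have hm0 : 0 ≤ m x := by
        by_contra! hneg
        exact absurd ((norm_nonneg _).trans h4)
          (not_le.2 (mul_neg_of_neg_of_pos hneg (Real.exp_pos _)))
      exact h4.trans (mul_le_mul_of_nonneg_left (Real.exp_le_exp.2 (le_max_left _ _)) hm0)
    have h6 : ‖(outer (un n) z)⁻¹ * Ψ z‖ ≤ ∫ t, m t ∂poisson z := by
      rw [hb z hz]
      refine (norm_integral_le_integral_norm _).trans (integral_mono_ae
        (MemLp.integrable_poisson hz' (Lp.memLp b)).norm (Integrable.poisson hm hI hz') ?_)
      exact (poisson_absolutelyContinuous z).ae_le hbm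
    rwa [norm_mul, norm_inv, norm_outer (hunI n) hz', inv_mul_le_iff₀ (Real.exp_pos _)] at h6
  have hlim : Tendsto (fun n => ∫ t, un n t ∂poisson z) atTop (𝓝 (∫ t, u t ∂poisson z)) := by
    refine tendsto_integral_of_dominated_convergence (fun t => ‖u t‖)
      (fun n => (Integrable.poisson (hunI n) hI hz').1) (Integrable.poisson hu hI hz').norm
      (fun n => ae_of_all _ fun t => ?_) (ae_of_all _ fun t => ?_)
    · simp only [hun, Real.norm_eq_abs]
      refine abs_le.2 ⟨(neg_abs_le _).trans (le_max_left _ _), max_le (le_abs_self _) ?_⟩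
      exact (neg_nonpos.2 (Nat.cast_nonneg n)).trans (abs_nonneg _)
    · refine tendsto_const_nhds.congr' ?_
      filter_upwards [eventually_ge_atTop ⌈-u t⌉₊] with n hn
      have : -u t ≤ n := (Nat.le_ceil _).trans (Nat.cast_le.2 hn)
      exact (max_eq_left (by linarith)).symm
  exact ge_of_tendsto (((Real.continuous_exp.tendsto _).comp hlim).mul_const _)
    (Eventually.of_forall hbd)

/-- The logarithm of the modulus of a non-zero `𝓗²` function is Poisson integrable on `ℝ`. -/
theorem IsHardy.integrable_log_norm {K : ℂ → ℂ} (hK : IsHardy 2 K) {k : ℝ → ℂ}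
    (hk : HasBoundaryFunction K k) {z : ℂ} (hz : z ∈ upperHalf) (hKz : K z ≠ 0) :
    (∀ᵐ x, k x ≠ 0) ∧ Integrable (fun x => Real.log ‖k x‖) (poisson Complex.I) := by
  have hI : 0 < Complex.I.im := by simp
  have hz' : 0 < z.im := hz
  have hPz := isProbabilityMeasure_poisson hz'
  have hkI := (MemLp.integrable_poisson hz' (hK.memLp_boundary hk)).norm
  have hkI1 : Integrable (fun t => ‖k t‖ + 1) (poisson z) := hkI.add (integrable_const 1)
  have hkm : AEMeasurable (fun x => ‖k x‖) (poisson z) := hkI.1.aemeasurable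
  set un : ℕ → ℝ → ℝ := fun n t => Real.log (max ‖k t‖ (Real.exp (-n))) with hun
  have hmaxpos : ∀ (n : ℕ) t, 0 < max ‖k t‖ (Real.exp (-n)) := fun n t =>
    lt_max_of_lt_right (Real.exp_pos _)
  have hle : ∀ n t, un n t ≤ ‖k t‖ + 1 := by
    intro n t
    refine (Real.log_le_sub_one_of_pos (hmaxpos n t)).trans ?_
    have : max ‖k t‖ (Real.exp (-n)) ≤ ‖k t‖ + 1 :=
      max_le (by linarith) ((Real.exp_le_one_iff.2 (by simp)).trans
        (by linarith [norm_nonneg (k t)]))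
    linarith
  have hge : ∀ (n : ℕ) (t : ℝ), -(n : ℝ) ≤ un n t := by
    intro n t
    rw [Real.le_log_iff_exp_le (hmaxpos n t)]
    exact le_max_right _ _
  have hunm : ∀ n, AEMeasurable (un n) (poisson z) := fun n =>
    Real.measurable_log.comp_aemeasurable (hkm.max aemeasurable_const)
  have hunI : ∀ n, Integrable (un n) (poisson z) := fun n => by
    refine ((hkI.add (integrable_const 1)).add (integrable_const (n : ℝ))).mono'
      (hunm n).aestronglyMeasurable (ae_of_all _ fun t => ?_)
    have h1 := hle n t
    have h2 := hge n t
    have h3 := norm_nonneg (k t)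
    have h4 : (0 : ℝ) ≤ n := Nat.cast_nonneg n
    rw [Real.norm_eq_abs]
    refine abs_le.2 ⟨?_, ?_⟩ <;> simp only [Pi.add_apply] <;> linarith
  -- Jensen's inequality for the truncated logarithm: the maximum principle with `m = 1`. The bound
  -- does not depend on `n`, and this is where `K z ≠ 0` enters.
  have hlow : ∀ n, Real.log ‖K z‖ ≤ ∫ t, un n t ∂poisson z := by
    intro n
    have hPI := isProbabilityMeasure_poisson hI
    rw [Real.log_le_iff_le_exp (norm_pos_iff.2 hKz)]
    have := hK.norm_le_exp_mul_integral hk (Integrable.poisson (hunI n) hz' hI)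
      (integrable_const 1) (ae_of_all _ fun t => ?_) hz
    · simpa using this
    · rw [one_mul, Real.exp_log (hmaxpos n t)]
      exact le_max_left _ _
  -- Subtracting from an integrable majorant gives a non-negative increasing sequence with bounded
  -- integrals. By monotone convergence its supremum is integrable, hence finite almost everywhere;
  -- it would be infinite at a zero of `k`.
  set vn : ℕ → ℝ → ℝ := fun n t => ‖k t‖ + 1 - un n t with hvn
  have hvn0 : ∀ n t, 0 ≤ vn n t := fun n t => sub_nonneg.2 (hle n t)
  have hvnI : ∀ n, Integrable (vn n) (poisson z) := fun n =>
    hkI1.sub (hunI n)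
  set M : ℝ := (∫ t, (‖k t‖ + 1) ∂poisson z) - Real.log ‖K z‖ with hM
  have hvnM : ∀ n, ∫⁻ t, ENNReal.ofReal (vn n t) ∂poisson z ≤ ENNReal.ofReal M := by
    intro n
    rw [← ofReal_integral_eq_lintegral_ofReal (hvnI n) (ae_of_all _ (hvn0 n))]
    refine ENNReal.ofReal_le_ofReal ?_
    simp only [hvn]
    rw [integral_sub hkI1 (hunI n)]
    linarith [hlow n]
  have hmono : ∀ t, Monotone fun n => ENNReal.ofReal (vn n t) := by
    intro t n n' hnn
    refine ENNReal.ofReal_le_ofReal (sub_le_sub_left (Real.log_le_log (hmaxpos n' t) ?_) _)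
    refine max_le_max le_rfl (Real.exp_le_exp.2 (neg_le_neg ?_))
    exact_mod_cast hnn
  have hsup : ∫⁻ t, ⨆ n, ENNReal.ofReal (vn n t) ∂poisson z ≤ ENNReal.ofReal M := by
    rw [lintegral_iSup' (fun n => (hvnI n).1.aemeasurable.ennreal_ofReal) (ae_of_all _ hmono)]
    exact iSup_le hvnM
  have hfin : ∀ᵐ t ∂poisson z, ⨆ n, ENNReal.ofReal (vn n t) < ⊤ :=
    ae_lt_top' (AEMeasurable.iSup fun n => (hvnI n).1.aemeasurable.ennreal_ofReal)
      (hsup.trans_lt ENNReal.ofReal_lt_top).ne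
  have hne : ∀ᵐ x ∂poisson z, k x ≠ 0 := by
    filter_upwards [hfin] with x hx h0
    refine hx.ne (ENNReal.eq_top_of_forall_nnreal_le fun r => ?_)
    obtain ⟨n, hn⟩ := exists_nat_ge (r : ℝ)
    refine le_trans ?_ (le_iSup (fun n => ENNReal.ofReal (vn n x)) n)
    rw [ENNReal.le_ofReal_iff_toReal_le ENNReal.coe_ne_top (hvn0 n x)]
    simp only [hvn, hun, h0, norm_zero, ENNReal.coe_toReal]
    rw [max_eq_right (Real.exp_pos _).le, Real.log_exp]
    linarith
  refine ⟨(absolutelyContinuous_poisson hz').ae_le hne, ?_⟩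
  have hw : Integrable (fun x => ‖k x‖ + 1 - Real.log ‖k x‖) (poisson z) := by
    refine ⟨((hkm.add_const 1).sub
      (Real.measurable_log.comp_aemeasurable hkm)).aestronglyMeasurable, ?_⟩
    refine lt_of_le_of_lt (lintegral_mono_ae ?_) (hsup.trans_lt ENNReal.ofReal_lt_top)
    filter_upwards [hne] with x hx
    obtain ⟨n, hn⟩ := exists_nat_ge (-Real.log ‖k x‖)
    refine le_trans (le_of_eq ?_) (le_iSup (fun n => ENNReal.ofReal (vn n x)) n)
    have hun' : un n x = Real.log ‖k x‖ := by
      simp only [hun]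
      rw [max_eq_left]
      rw [← Real.le_log_iff_exp_le (norm_pos_iff.2 hx)]
      linarith
    rw [← ofReal_norm, ← hun', Real.norm_of_nonneg (hvn0 n x)]
  have := hkI1.sub hw
  refine Integrable.poisson (this.congr (ae_of_all _ fun x => ?_)) hz' hI
  simp

end Jensen

/-! ### The outer factor. -/

section Factorization

/-- The outer factor of a non-zero `𝓗²` function. -/
theorem IsHardy.exists_outer_factor {K : ℂ → ℂ} (hK : IsHardy 2 K) {k : ℝ → ℂ}
    (hk : HasBoundaryFunction K k) {z : ℂ} (hz : z ∈ upperHalf) (hKz : K z ≠ 0) :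
    ∃ (u : ℝ → ℝ) (o : ℝ → ℂ), Integrable u (poisson Complex.I) ∧ IsHardy 2 (outer u) ∧
      HasBoundaryFunction (outer u) o ∧ (∀ᵐ x, Real.exp (u x) = ‖k x‖) ∧
      (∀ᵐ x, ‖o x‖ = Real.exp (u x)) ∧
      ∀ w ∈ upperHalf, ‖K w / outer u w‖ ≤ 1 := by
  have hI : 0 < Complex.I.im := by simp
  obtain ⟨hne, hlog⟩ := hK.integrable_log_norm hk hz hKz
  set u : ℝ → ℝ := fun x => Real.log ‖k x‖ with hu
  have hexp : ∀ᵐ x, Real.exp (u x) = ‖k x‖ := by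
    filter_upwards [hne] with x hx using Real.exp_log (norm_pos_iff.2 hx)
  have hkL := hK.memLp_boundary hk
  have hO : IsHardy 2 (outer u) := by
    -- Convexity of the exponential bounds `|outer u|` by the Poisson integral of `exp u = |k|`,
    -- which is in `L²`.
    refine isHardy_two_of_norm_le_integral (differentiableOn_outer hlog) hkL.norm fun w hw => ?_
    have hw' : 0 < w.im := hw
    have hexpw := (poisson_absolutelyContinuous w).ae_le hexp
    rw [norm_outer hlog hw', ← integral_congr_ae hexpw]
    exact exp_integral_poisson_le hw' (Integrable.poisson hlog hI hw')
      ((MemLp.integrable_poisson hw' hkL).norm.congr (EventuallyEq.symm hexpw))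
  obtain ⟨o, -, ho⟩ := hO.exists_eq_integral_poisson
  refine ⟨u, o, hlog, hO, ho, hexp, ?_, fun w hw => ?_⟩
  · filter_upwards [ho, ae_tendsto_norm_outer hlog] with x h1 h2
    have hn := neBot_stolzAngle one_pos x
    exact tendsto_nhds_unique (h1 1 one_pos).norm (h2 1)
  · have hw' : 0 < w.im := hw
    have hPI := isProbabilityMeasure_poisson hI
    have hPw := isProbabilityMeasure_poisson hw'
    rw [norm_div, norm_outer hlog hw', div_le_one (Real.exp_pos _)]
    have := hK.norm_le_exp_mul_integral hk hlog (integrable_const 1)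
      (hexp.mono fun x hx => by rw [one_mul, hx]) hw
    simpa using this

end Factorization

/-! ### Passing between `𝓗²` and the Smirnov class. -/

section Smirnov

lemma IsHardy.exists_norm_le {G : ℂ → ℂ} (hG : IsHardy ∞ G) :
    ∃ M : ℝ, ∀ z ∈ upperHalf, ‖G z‖ ≤ M := by
  obtain ⟨hd, C, hC⟩ := hG
  refine ⟨C, fun z hz => ?_⟩
  have hz' : 0 < z.im := hz
  have hae : ∀ᵐ x : ℝ, ‖G ((x : ℂ) + (z.im : ℂ) * Complex.I)‖ ≤ C := by
    filter_upwards [ae_le_eLpNormEssSup (f := fun x : ℝ => G ((x : ℂ) + (z.im : ℂ) * Complex.I))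
      (μ := volume)] with x hx
    have := hx.trans ((eLpNorm_exponent_top (f := fun x : ℝ =>
      G ((x : ℂ) + (z.im : ℂ) * Complex.I)) (μ := volume)).symm.trans_le (hC _ hz'))
    rw [← ofReal_norm, ← ENNReal.ofReal_coe_nnreal] at this
    exact (ENNReal.ofReal_le_ofReal_iff C.coe_nonneg).1 this
  have hcl : IsClosed {x : ℝ | ‖G ((x : ℂ) + (z.im : ℂ) * Complex.I)‖ ≤ C} :=
    isClosed_le (continuous_horizontal hd hz').norm continuous_const
  have h : ‖G ((z.re : ℂ) + (z.im : ℂ) * Complex.I)‖ ≤ C :=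
    hcl.closure_subset (Measure.dense_of_ae hae z.re)
  rwa [Complex.re_add_im] at h

lemma isHardy_top_of_norm_le {G : ℂ → ℂ} (hG : DifferentiableOn ℂ G upperHalf) {M : ℝ}
    (hM : ∀ z ∈ upperHalf, ‖G z‖ ≤ M) : IsHardy ∞ G := by
  refine ⟨hG, M.toNNReal, fun y hy => ?_⟩
  rw [eLpNorm_exponent_top]
  exact eLpNormEssSup_le_of_ae_bound
    (ae_of_all _ fun x => hM _ (by simpa [upperHalf] using hy))

lemma HasBoundaryFunction.congr_left {F F' : ℂ → ℂ} {f : ℝ → ℂ} (hf : HasBoundaryFunction F f)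
    (h : ∀ z ∈ upperHalf, F z = F' z) : HasBoundaryFunction F' f := by
  filter_upwards [hf] with x hx a ha
  exact (hx a ha).congr' (eventually_nhdsWithin_of_forall fun z hz => h z hz.1)

lemma HasBoundaryFunction.div {F G : ℂ → ℂ} {f g : ℝ → ℂ} (hf : HasBoundaryFunction F f)
    (hg : HasBoundaryFunction G g) (hne : ∀ᵐ x, g x ≠ 0) :
    HasBoundaryFunction (fun z => F z / G z) fun x => f x / g x := by
  filter_upwards [hf, hg, hne] with x h1 h2 h3 a ha using (h1 a ha).div (h2 a ha) h3

lemma IsHardy.exists_ne_zero {F : ℂ → ℂ} {f : ℝ → ℂ} (hf : HasBoundaryFunction F f)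
    (hne : ¬ f =ᵐ[volume] 0) : ∃ z ∈ upperHalf, F z ≠ 0 := by
  by_contra! hcon
  refine hne (hf.ae_eq (HasBoundaryFunction.congr_left (F := fun _ => 0) (f := 0) ?_
    fun z hz => (hcon z hz).symm))
  exact ae_of_all _ fun x a _ => tendsto_const_nhds

lemma ae_ne_zero_of_mem_hardy {f : Lp ℂ 2 (volume : Measure ℝ)} (hf : f ∈ hardy 2)
    (hne : f ≠ 0) : ∀ᵐ x, f x ≠ 0 := by
  obtain ⟨F, hF, hFf⟩ := hf
  obtain ⟨z, hz, hFz⟩ := IsHardy.exists_ne_zero hFf fun h => hne ((Lp.eq_zero_iff_ae_eq_zero).2 h)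
  exact (hF.integrable_log_norm hFf hz hFz).1

/-- The Smirnov theorem: `𝓝⁺ ∩ L² = 𝓗²₊`, for functions given as products. -/
theorem mem_hardy_of_mul_smirnov {φ : ℝ → ℂ} (hφ : φ ∈ smirnov)
    {k l : Lp ℂ 2 (volume : Measure ℝ)} (hk : k ∈ hardy 2)
    (hl : (l : ℝ → ℂ) =ᵐ[volume] fun x => φ x * k x) : l ∈ hardy 2 := by
  obtain ⟨Φ, ⟨G, F, hG, -, hFo, hΦ⟩, hΦφ⟩ := hφ
  obtain ⟨K, hK, hKk⟩ := hk
  obtain ⟨u, hu, hFu⟩ := hFo.exists_eq_outer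
  obtain ⟨M, hM⟩ := hG.exists_norm_le
  have hI : 0 < Complex.I.im := by simp
  have hΨ := hK.mul_of_bounded hG.1 hM
  obtain ⟨ψ, -, hψ⟩ := hΨ.exists_eq_integral_poisson
  have hprod : ∀ z ∈ upperHalf, Φ z * K z = (G z * K z) / outer u z := by
    intro z hz
    rw [hΦ z hz, hFu z hz]
    ring
  have hb : HasBoundaryFunction (fun z => Φ z * K z) l := (hΦφ.mul hKk).congr hl.symm
  refine ⟨fun z => Φ z * K z, ?_, hb⟩
  -- With `m = |l|`, the maximum principle applied to `G K` bounds `Φ K = G K / outer u` by the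
  -- Poisson integral of `|l|`, because the factor `exp` of the Poisson integral of `u` cancels.
  have hψl : ∀ᵐ x, ‖ψ x‖ ≤ ‖l x‖ * Real.exp (u x) := by
    filter_upwards [hψ, hb, ae_tendsto_norm_outer hu] with x h1 h2 h3
    have hn := neBot_stolzAngle one_pos x
    refine le_of_eq (tendsto_nhds_unique (h1 1 one_pos).norm
      (((h2 1 one_pos).norm.mul (h3 1)).congr' ?_))
    refine eventually_nhdsWithin_of_forall fun z hz => ?_
    beta_reduce
    rw [hprod z hz.1, norm_div, div_mul_cancel₀ _ (norm_ne_zero_iff.2 (outer_ne_zero _ _))]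
  have hlL := Lp.memLp l
  refine isHardy_two_of_norm_le_integral ?_ hlL.norm fun z hz => ?_
  · exact ((hΨ.1.div (differentiableOn_outer hu) fun z _ => outer_ne_zero _ _).congr hprod)
  · have hz' : 0 < z.im := hz
    rw [hprod z hz, norm_div, norm_outer hu hz', div_le_iff₀ (Real.exp_pos _),
      mul_comm _ (Real.exp _)]
    exact hΨ.norm_le_exp_mul_integral hψ hu (MemLp.integrable_poisson hI hlL).norm hψl hz

/-- The quotient of an `𝓗²` function by an outer `𝓗²` function is in the Smirnov class. -/
theorem div_mem_smirnov {L : ℂ → ℂ} {l o : ℝ → ℂ} {u : ℝ → ℝ} (hL : IsHardy 2 L)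
    (hl : HasBoundaryFunction L l) (hu : Integrable u (poisson Complex.I))
    (hO : IsHardy 2 (outer u)) (ho : HasBoundaryFunction (outer u) o)
    (hou : ∀ᵐ x, ‖o x‖ = Real.exp (u x)) : (fun x => l x / o x) ∈ smirnov := by
  have hI : 0 < Complex.I.im := by simp
  have hPI := isProbabilityMeasure_poisson hI
  have hlI := (MemLp.integrable_poisson hI (hL.memLp_boundary hl)).norm
  have hoI := (MemLp.integrable_poisson hI (hO.memLp_boundary ho)).norm
  -- Dividing numerator and denominator by the outer function of modulus `w` makes both bounded by
  -- `1`. The entry `1` ensures `0 ≤ log w ≤ |l| + |o|`, hence integrability.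
  set w : ℝ → ℝ := fun x => max (max ‖l x‖ ‖o x‖) 1 with hw
  have hw1 : ∀ x, 1 ≤ w x := fun x => le_max_right _ _
  set v : ℝ → ℝ := fun x => Real.log (w x) with hv
  have hexp : ∀ x, Real.exp (v x) = w x := fun x => Real.exp_log (one_pos.trans_le (hw1 x))
  have hvI : Integrable v (poisson Complex.I) := by
    refine (hlI.add hoI).mono' (Real.measurable_log.comp_aemeasurable
      ((hlI.1.aemeasurable.max hoI.1.aemeasurable).max aemeasurable_const)).aestronglyMeasurable
      (ae_of_all _ fun x => ?_)
    rw [Real.norm_of_nonneg (Real.log_nonneg (hw1 x))]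
    refine (Real.log_le_sub_one_of_pos (one_pos.trans_le (hw1 x))).trans ?_
    have h1 := norm_nonneg (l x)
    have h2 := norm_nonneg (o x)
    have : w x ≤ ‖l x‖ + ‖o x‖ + 1 :=
      max_le (max_le (by linarith) (by linarith)) (by linarith)
    simp only [Pi.add_apply]
    linarith
  have huv : ∀ᵐ x, u x ≤ v x := by
    filter_upwards [hou] with x hx
    rw [← Real.exp_le_exp, ← hx, hexp]
    exact (le_max_right _ _).trans (le_max_left _ _)
  have huvI : Integrable (fun x => u x - v x) (poisson Complex.I) := hu.sub hvI
  have hlv : ∀ᵐ x, ‖l x‖ ≤ 1 * Real.exp (v x) := ae_of_all _ fun x => by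
    rw [one_mul, hexp]
    exact (le_max_left _ _).trans (le_max_left _ _)
  refine ⟨fun z => L z / outer u z, ⟨fun z => L z / outer v z, outer fun x => u x - v x,
    isHardy_top_of_norm_le (M := 1) (hL.1.div (differentiableOn_outer hvI)
      fun z _ => outer_ne_zero _ _) fun z hz => ?_,
    isHardy_top_of_norm_le (M := 1) (differentiableOn_outer huvI) fun z hz => ?_,
    isOuter_outer huvI, fun z hz => ?_⟩, hl.div ho ?_⟩
  · have hz' : 0 < z.im := hz
    have hPz := isProbabilityMeasure_poisson hz'
    rw [norm_div, norm_outer hvI hz', div_le_one (Real.exp_pos _)]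
    simpa using hL.norm_le_exp_mul_integral hl hvI (integrable_const 1) hlv hz
  · have hz' : 0 < z.im := hz
    rw [norm_outer huvI hz', Real.exp_le_one_iff]
    refine integral_nonpos_of_ae ((poisson_absolutelyContinuous z).ae_le ?_)
    filter_upwards [huv] with x hx using sub_nonpos.2 hx
  · have hz' : 0 < z.im := hz
    have h1 := outer_ne_zero u z
    have h2 := outer_ne_zero v z
    rw [outer_sub hu hvI hz']
    field_simp
  · filter_upwards [hou] with x hx h0
    rw [h0, norm_zero] at hx
    exact (Real.exp_pos _).ne hx

end Smirnov

/-! ### Kernels of the generalized Toeplitz operators. -/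

section ToeplitzKernels

variable {q g : Lp ℂ ∞ (volume : Measure ℝ)} {f : Lp ℂ 2 (volume : Measure ℝ)}

/-- The complex conjugate of `q̄ g f`. -/
def conjSymbolMul (q g : Lp ℂ ∞ (volume : Measure ℝ)) (f : Lp ℂ 2 (volume : Measure ℝ)) :
    Lp ℂ 2 (volume : Measure ℝ) :=
  star (mulOp (star q) (mulOp g f))

lemma coeFn_conjSymbolMul (q g : Lp ℂ ∞ (volume : Measure ℝ))
    (f : Lp ℂ 2 (volume : Measure ℝ)) :
    conjSymbolMul q g f =ᵐ[volume]
      fun x => q x * (starRingEnd ℂ) (g x) * (starRingEnd ℂ) (f x) := by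
  filter_upwards [Lp.coeFn_star (mulOp (star q) (mulOp g f)), coeFn_mulOp (star q) (mulOp g f),
    coeFn_mulOp g f, Lp.coeFn_star q] with x h1 h2 h3 h4
  rw [conjSymbolMul, h1, Pi.star_apply, h2, h3, h4]
  simp
  ring

lemma inner_mulOp_left (q : Lp ℂ ∞ (volume : Measure ℝ)) (p f : Lp ℂ 2 (volume : Measure ℝ)) :
    inner ℂ (mulOp q p) f = inner ℂ p (mulOp (star q) f) := by
  rw [L2.inner_def, L2.inner_def]
  refine integral_congr_ae ?_
  filter_upwards [coeFn_mulOp q p, coeFn_mulOp (star q) f, Lp.coeFn_star q] with x h1 h2 h3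
  rw [h1, h2, h3]
  simp
  ring

/-- `f ∈ 𝓗²₊` belongs to the kernel of `T_g : 𝓗²₊ → q 𝓗²₊` if and only if `q̄ g f` is the complex
conjugate of an element of `𝓗²₊`. -/
lemma mem_toeplitzKer_shiftedHardy :
    f ∈ toeplitzKer g (hardy 2) (shiftedHardy q) ↔
      f ∈ hardy 2 ∧ conjSymbolMul q g f ∈ hardy 2 := by
  rw [mem_toeplitzKer, conjSymbolMul, ← mem_hardy_two_orthogonal_iff]
  refine and_congr_right fun _ => ?_
  simp only [Submodule.mem_orthogonal, shiftedHardy, Submodule.mem_map,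
    forall_exists_index, and_imp, forall_apply_eq_imp_iff₂]
  refine forall₂_congr fun p _ => ?_
  rw [← inner_mulOp_left]
  rfl

/-- A non-trivial Toeplitz kernel contains a function whose associated conjugate function is
outer. -/
lemma exists_mem_toeplitzKer_outer (hq : ∀ᵐ x : ℝ, ‖q x‖ = 1) (hg : g ≠ 0)
    (hker : toeplitzKer g (hardy 2) (shiftedHardy q) ≠ ⊥) :
    ∃ f ∈ toeplitzKer g (hardy 2) (shiftedHardy q), ∃ u : ℝ → ℝ,
      Integrable u (poisson Complex.I) ∧ IsHardy 2 (outer u) ∧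
      HasBoundaryFunction (outer u) (conjSymbolMul q g f) ∧
      ∀ᵐ x, ‖conjSymbolMul q g f x‖ = Real.exp (u x) := by
  obtain ⟨f, hf, hf0⟩ := (Submodule.ne_bot_iff _).1 hker
  obtain ⟨hfH, hkH⟩ := mem_toeplitzKer_shiftedHardy.1 hf
  have hfne := ae_ne_zero_of_mem_hardy hfH hf0
  have hk0 : ¬ (conjSymbolMul q g f : ℝ → ℂ) =ᵐ[volume] 0 := by
    intro h
    refine hg ((Lp.eq_zero_iff_ae_eq_zero).2 ?_)
    filter_upwards [h, coeFn_conjSymbolMul q g f, hfne, hq] with x h1 h2 h3 h4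
    rw [h1] at h2
    have hq0 : q x ≠ 0 := norm_ne_zero_iff.1 (by rw [h4]; exact one_ne_zero)
    simpa [hq0, h3] using h2.symm
  obtain ⟨F, hF, hFf⟩ := hfH
  obtain ⟨K, hK, hKk⟩ := hkH
  obtain ⟨z, hz, hKz⟩ := IsHardy.exists_ne_zero hKk hk0
  obtain ⟨u, o, hu, hO, ho, huk, hou, hJ⟩ := hK.exists_outer_factor hKk hz hKz
  have hone : ∀ᵐ x, o x ≠ 0 := by
    filter_upwards [hou] with x hx h0
    rw [h0, norm_zero] at hx
    exact (Real.exp_pos _).ne hx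
  -- The new kernel element is the boundary function of `J F`, where `J = K / outer u` is bounded by
  -- `1`.
  have hJF := hF.mul_of_bounded
    (hK.1.div (differentiableOn_outer hu) fun z _ => outer_ne_zero _ _) hJ
  obtain ⟨f', -, hf'⟩ := hJF.exists_eq_integral_poisson
  have hf'eq := hf'.ae_eq ((hKk.div ho hone).mul hFf)
  -- Conjugation turns the factor `J = k / o` of `f'` into `conj k / conj o`, and `|k| = |o|` gives
  -- `conj k * k / conj o = o`.
  have hko : (conjSymbolMul q g f' : ℝ → ℂ) =ᵐ[volume] o := by
    filter_upwards [coeFn_conjSymbolMul q g f, coeFn_conjSymbolMul q g f', hf'eq, hone, huk, hou]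
      with x h1 h2 h3 h4 h5 h6
    have h7 : (starRingEnd ℂ) (conjSymbolMul q g f x) * conjSymbolMul q g f x =
        (starRingEnd ℂ) (o x) * o x := by
      rw [Complex.conj_mul', Complex.conj_mul', h6, h5]
    have h8 : (starRingEnd ℂ) (o x) ≠ 0 := (map_ne_zero _).2 h4
    rw [h2, h3]
    calc _ = (starRingEnd ℂ) (conjSymbolMul q g f x) * (q x * (starRingEnd ℂ) (g x) *
          (starRingEnd ℂ) (f x)) / (starRingEnd ℂ) (o x) := by
          simp only [map_mul, map_div₀]
          ring
      _ = o x := by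
          rw [← h1, h7]
          field_simp
  refine ⟨f', mem_toeplitzKer_shiftedHardy.2 ⟨⟨_, hJF, hf'⟩, ⟨_, hO, ho.congr hko.symm⟩⟩, u, hu,
    hO, ho.congr hko.symm, ?_⟩
  filter_upwards [hko, hou] with x h1 h2
  rw [h1, h2]

end ToeplitzKernels

end ToeplitzKernel

end

/-! ### The equivalence. -/

theorem mainTheorem6 (q g h : MeasureTheory.Lp ℂ ∞ (volume : Measure ℝ))
    (hq : ToeplitzKernel.IsInner q) (hg : g ≠ 0) (hh : h ≠ 0)
    (hgker : ToeplitzKernel.toeplitzKer g (ToeplitzKernel.hardy 2)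
      (ToeplitzKernel.shiftedHardy q) ≠ ⊥)
    (hhker : ToeplitzKernel.toeplitzKer h (ToeplitzKernel.hardy 2)
      (ToeplitzKernel.shiftedHardy q) ≠ ⊥) :
    (fun x : ℝ => h x * (g x)⁻¹) ∈ ToeplitzKernel.conjSmirnov ↔
      ToeplitzKernel.toeplitzKer g (ToeplitzKernel.hardy 2) (ToeplitzKernel.shiftedHardy q) ≤
        ToeplitzKernel.toeplitzKer h (ToeplitzKernel.hardy 2) (ToeplitzKernel.shiftedHardy q) := by
  open ToeplitzKernel in
  obtain ⟨f₀, hf₀, u, hu, hO, ho, hou⟩ := exists_mem_toeplitzKer_outer hq.2 hg hgker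
  have hne : ∀ᵐ x, conjSymbolMul q g f₀ x ≠ 0 := by
    filter_upwards [hou] with x hx h0
    rw [h0, norm_zero] at hx
    exact (Real.exp_pos _).ne hx
  -- In particular `g` vanishes almost nowhere, so the convention `0⁻¹ = 0` has no effect on `h x *
  -- (g x)⁻¹`.
  have hne' : ∀ᵐ x, q x ≠ 0 ∧ g x ≠ 0 ∧ f₀ x ≠ 0 := by
    filter_upwards [hne, coeFn_conjSymbolMul q g f₀] with x h1 h2
    rw [h2] at h1
    simpa [and_assoc] using h1
  constructor
  · intro hφ f hf
    rw [mem_toeplitzKer_shiftedHardy] at hf ⊢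
    refine ⟨hf.1, mem_hardy_of_mul_smirnov hφ hf.2 ?_⟩
    filter_upwards [coeFn_conjSymbolMul q g f, coeFn_conjSymbolMul q h f, hne'] with x h1 h2 h3
    have h4 : (starRingEnd ℂ) (g x) ≠ 0 := (map_ne_zero _).2 h3.2.1
    rw [h1, h2, map_mul, map_inv₀]
    field_simp
  · intro hle
    -- The inclusion is used only for `f₀`: the quotient of its two conjugate functions is `conj (h
    -- / g)`, as `q` and `conj f₀` cancel.
    obtain ⟨-, L, hL, hLl⟩ := mem_toeplitzKer_shiftedHardy.1 (hle hf₀)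
    obtain ⟨Φ, hΦ, hb⟩ := div_mem_smirnov hL hLl hu hO ho hou
    refine ⟨Φ, hΦ, hb.congr ?_⟩
    filter_upwards [coeFn_conjSymbolMul q g f₀, coeFn_conjSymbolMul q h f₀, hne'] with x h1 h2 h3
    have h4 : (starRingEnd ℂ) (g x) ≠ 0 := (map_ne_zero _).2 h3.2.1
    have h5 : (starRingEnd ℂ) (f₀ x) ≠ 0 := (map_ne_zero _).2 h3.2.2
    have h6 := h3.1
    rw [h1, h2, map_mul, map_inv₀]
    field_simp
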